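/- Let $X$ be a quandle, i.e. a set with a binary operation $\lhd$ such that $a\lhd a=a$, each map $\bullet\lhd a$ is bijective, and $(a\lhd b)\lhd c=(a\lhd c)\lhd(b\lhd c)$. Let $\mathrm{As}(X)=\langle e_x\ (x\in X)\mid e_xe_y=e_ye_{x\lhd y}\ (x,y\in X)\rangle$ be its associated group, acting on $X$ from the right by $x\cdot e_y=x\lhd y$. Assume that $X$ is connected, i.e. this action is transitive, and of finite type $t_X$, i.e. $t_X$ is the least integer $N>0$ such that the $N$-fold operation $(\cdots((x\lhd y)\lhd y)\cdots)\lhd y$ equals $x$ for all $x,y\in X$. For a right $\mathrm{As}(X)$-set $Y$, let $B(X,Y)$ be the action rack space: the cell complex with one $n$-cube $(y;x_1,\dots,x_n)$ for each element of $Y\times X^n$ ($n\ge 0$), whose face $t_i=0$ is glued to $(y;x_1,\dots,x_{i-1},x_{i+1},\dots,x_n)$ and whose face $t_i=1$ is glued to $(y\cdot e_{x_i};x_1\lhd x_i,\dots,x_{i-1}\lhd x_i,x_{i+1},\dots,x_n)$. Let $BX=B(X,\mathrm{pt})$ be the rack space, so that $\pi_1(BX)=\mathrm{As}(X)$ and $B(X,\mathrm{As}(X))$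 is the universal covering of $BX$. Let $c: BX\to K(\mathrm{As}(X),1)$ be the classifying map, inducing the identity on $\pi_1$; on cellular chains it is represented by any $\mathrm{As}(X)$-equivariant, augmentation-preserving chain map from the cellular chain complex of $B(X,\mathrm{As}(X))$ to the standard resolution of $\mathbb Z$ over $\mathrm{As}(X)$. Let $c_*:H_n(BX;\mathbb Z)\to H_n^{\mathrm{gr}}(\mathrm{As}(X);\mathbb Z)$ be the induced map, where $H_n(BX;\mathbb Z)$ is the cellular homology of $BX$ and $H_n^{\mathrm{gr}}$ is group homology. Theorem. For $n=2$ and $n=3$, the map $c_*: H_n(BX;\mathbb Z)\to H_n^{\mathrm{gr}}(\mathrm{As}(X);\mathbb Z)$ is annihilated by $t_X$, that is, $t_X\cdot c_*(z)=0$ for every $z\in H_n(BX;\mathbb Z)$. -/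

import Mathlib

universe u

open CategoryTheory

noncomputable section

/-! ### Quandles, the associated group, connectedness, type -/

section Quandles

variable (X : Type u) [Quandle X]

/-- The right quandle operation `x ◁ y` (that is, `y` acts on `x`). Mathlib writes the same operation
with the acting element on the left. -/
def Quandle.tri {X : Type u} [Quandle X] (x y : X) : X := Shelf.act y x

theorem Quandle.tri_tri {X : Type u} [Quandle X] (a b c : X) :
    Quandle.tri (Quandle.tri a b) c = Quandle.tri (Quandle.tri a c) (Quandle.tri b c) :=
  Shelf.self_distrib

/-- The relators `e_{x ◁ y}⁻¹ e_y⁻¹ e_x e_y` of the associated group. -/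
def AssociatedGroup.relators : Set (FreeGroup X) :=
  {r | ∃ x y : X, r = (FreeGroup.of (Quandle.tri x y))⁻¹ * (FreeGroup.of y)⁻¹ *
    FreeGroup.of x * FreeGroup.of y}

/-- The associated group `As(X)`: generators `e_x` for `x : X`, relations
`e_x e_y = e_y e_{x ◁ y}`. -/
abbrev AssociatedGroup : Type u := PresentedGroup (AssociatedGroup.relators X)

variable {X} in
/-- The generator `e_x` of `As(X)`. -/
def AssociatedGroup.e (x : X) : AssociatedGroup X := PresentedGroup.of x

variable {X} in
theorem AssociatedGroup.e_mul_e (x y : X) :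
    AssociatedGroup.e x * AssociatedGroup.e y =
      AssociatedGroup.e y * AssociatedGroup.e (Quandle.tri x y) := by
  have h : PresentedGroup.mk (AssociatedGroup.relators X)
      ((FreeGroup.of (Quandle.tri x y))⁻¹ * (FreeGroup.of y)⁻¹ *
        FreeGroup.of x * FreeGroup.of y) = 1 :=
    PresentedGroup.one_of_mem ⟨x, y, rfl⟩
  simp only [map_mul, map_inv] at h
  change (AssociatedGroup.e _)⁻¹ * (AssociatedGroup.e _)⁻¹ * AssociatedGroup.e _ *
    AssociatedGroup.e _ = 1 at h
  rw [← mul_inv_rev, mul_assoc, inv_mul_eq_one] at h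
  exact h.symm

/-- The right action of `As(X)` on `X` determined by `x · e_y = x ◁ y`, as a homomorphism from
`As(X)` to the opposite of the permutation group of `X`. -/
def AssociatedGroup.toPerm : AssociatedGroup X →* (Equiv.Perm X)ᵐᵒᵖ :=
  PresentedGroup.toGroup (f := fun y : X => MulOpposite.op (Rack.act' y)) (by
    rintro _ ⟨x, y, rfl⟩
    simp only [map_mul, map_inv, FreeGroup.lift_apply_of, Quandle.tri, Rack.ad_conj]
    apply MulOpposite.unop_injective
    simp [mul_assoc])

/-- `X` is a right `As(X)`-set by `x · e_y = x ◁ y`. -/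
instance AssociatedGroup.mulActionSelf : MulAction (AssociatedGroup X)ᵐᵒᵖ X where
  smul g x := (AssociatedGroup.toPerm X g.unop).unop x
  one_smul x := by
    change (AssociatedGroup.toPerm X 1).unop x = x
    simp
  mul_smul g h x := by
    change (AssociatedGroup.toPerm X (h.unop * g.unop)).unop x = _
    rw [map_mul]
    rfl

theorem AssociatedGroup.op_e_smul (x y : X) :
    MulOpposite.op (AssociatedGroup.e y) • x = Quandle.tri x y := by
  change (AssociatedGroup.toPerm X (PresentedGroup.of y)).unop x = _
  rw [AssociatedGroup.toPerm, PresentedGroup.toGroup.of]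
  rfl

/-- A quandle is connected if the action of `As(X)` on it is transitive. -/
def Quandle.IsConnected : Prop := MulAction.IsPretransitive (AssociatedGroup X)ᵐᵒᵖ X

/-- `X` is of (finite) type `t`: `t` is the least `N > 0` such that the `N`-fold right operation
`• ◁ y` is the identity for all `y`. -/
def Quandle.IsOfType (t : ℕ) : Prop :=
  IsLeast {N : ℕ | 0 < N ∧ ∀ x y : X, (fun z => Quandle.tri z y)^[N] x = x} t

end Quandles

/-! ### Precubical sets and their cellular chain complexes -/

/-- A precubical set (`□`-set): a set of `n`-cubes for each `n`, with the two faces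
`{t_i = 0}` (`face false i`) and `{t_i = 1}` (`face true i`) in each coordinate direction.
It is the gluing datum of a space built from cubes `[0,1]^n`. -/
structure PrecubicalSet : Type (u + 1) where
  cell : ℕ → Type u
  face : ∀ {n : ℕ}, Bool → Fin (n + 1) → cell (n + 1) → cell n
  face_face : ∀ {n : ℕ} (ε η : Bool) (i j : Fin (n + 1)), i ≤ j → ∀ c : cell (n + 2),
    face ε i (face η j.succ c) = face η j (face ε i.castSucc c)

namespace PrecubicalSet

variable (k : Type u) [CommRing k] (K : PrecubicalSet.{u})

/-- The cellular boundary `∂ c = ∑_i (-1)^i ({t_i = 1} - {t_i = 0})`, where the coordinates are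
numbered from `1`. -/
def boundary (n : ℕ) : (K.cell (n + 1) →₀ k) →ₗ[k] (K.cell n →₀ k) :=
  Finsupp.linearCombination k fun c => ∑ i : Fin (n + 1), (-1 : k) ^ ((i : ℕ) + 1) •
    (Finsupp.single (K.face true i c) 1 - Finsupp.single (K.face false i c) 1)

theorem boundary_single (n : ℕ) (c : K.cell (n + 1)) :
    K.boundary k n (Finsupp.single c 1) = ∑ i : Fin (n + 1), (-1 : k) ^ ((i : ℕ) + 1) •
      (Finsupp.single (K.face true i c) 1 - Finsupp.single (K.face false i c) 1) := by
  simp [boundary]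

theorem sum_sum_split {M : Type*} [AddCommMonoid M] {n : ℕ} (f : Fin (n + 2) → Fin (n + 1) → M) :
    ∑ j, ∑ i, f j i = ∑ i : Fin (n + 1), ∑ j : Fin (n + 1),
      ((if i ≤ j then f j.succ i else 0) + (if i ≤ j then f i.castSucc j else 0)) := by
  have h1 : ∀ i : Fin (n + 1), ∑ j, f j i =
      ∑ j : Fin (n + 1), ((if i ≤ j then f j.succ i else 0) +
        (if j ≤ i then f j.castSucc i else 0)) := by
    intro i
    rw [Fin.sum_univ_succAbove _ i.castSucc, Finset.sum_add_distrib]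
    have h2 : ∀ j : Fin (n + 1), f (i.castSucc.succAbove j) i =
        (if i ≤ j then f j.succ i else 0) + (if j < i then f j.castSucc i else 0) := by
      intro j
      by_cases h : j < i
      · rw [Fin.succAbove_of_castSucc_lt _ _ (by simpa using h)]
        simp [h, not_le.2 h]
      · rw [Fin.succAbove_of_le_castSucc _ _ (by simpa using h)]
        simp [h, not_lt.1 h]
    simp only [h2, Finset.sum_add_distrib]
    have h3 : ∀ j : Fin (n + 1), (if j ≤ i then f j.castSucc i else 0) =
        (if j < i then f j.castSucc i else 0) + (if j = i then f i.castSucc i else 0) := by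
      intro j
      rcases lt_trichotomy j i with h | h | h
      · simp [h, h.le, h.ne]
      · simp [h]
      · simp [not_le.2 h, not_lt.2 h.le, h.ne']
    simp only [h3, Finset.sum_add_distrib]
    simp
    abel
  rw [Finset.sum_comm]
  simp only [h1, Finset.sum_add_distrib]
  congr 1
  exact Finset.sum_comm

theorem boundary_boundary (n : ℕ) : K.boundary k n ∘ₗ K.boundary k (n + 1) = 0 := by
  refine Finsupp.lhom_ext' fun c => LinearMap.ext_ring ?_
  simp only [LinearMap.comp_apply, Finsupp.lsingle_apply, LinearMap.zero_apply, boundary_single,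
    map_sum, map_smul, map_sub, ← Finset.sum_sub_distrib, ← smul_sub, Finset.smul_sum]
  rw [sum_sum_split]
  refine Finset.sum_eq_zero fun i _ => Finset.sum_eq_zero fun j _ => ?_
  by_cases h : i ≤ j
  · simp only [h, if_true, K.face_face _ _ i j h, smul_smul, ← pow_add, Fin.val_succ,
      Fin.val_castSucc]
    rw [show (j : ℕ) + 1 + 1 + (i + 1) = (i + 1 + (j + 1)) + 1 by ring, pow_succ, mul_neg_one,
      neg_smul, neg_add_eq_sub, ← smul_sub]
    convert smul_zero _
    abel
  · simp [h]

/-- The cellular chain complex of (the geometric realization of) a precubical set. -/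
def cellularComplex : ChainComplex (ModuleCat.{u} k) ℕ :=
  ChainComplex.of (fun n => ModuleCat.of k (K.cell n →₀ k))
    (fun n => ModuleCat.ofHom (K.boundary k n)) (fun n => by
      rw [← ModuleCat.ofHom_comp, boundary_boundary]
      rfl)

end PrecubicalSet

theorem PrecubicalSet.cellularComplex_d (k : Type u) [CommRing k] (K : PrecubicalSet.{u}) (n : ℕ) :
    (K.cellularComplex k).d (n + 1) n = ModuleCat.ofHom (K.boundary k n) := by
  simp [cellularComplex]

/-! ### The rack space -/

section RackSpace

variable (X : Type u) [Quandle X]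

/-- The face `{t_i = 1}` of the cube `(x_1, …, x_n)`: delete `x_i` and let it act on the entries
to its left. -/
def Quandle.actDelete {X : Type u} [Quandle X] {n : ℕ} (i : Fin (n + 1)) (x : Fin (n + 1) → X) :
    Fin n → X :=
  fun l => if l.castSucc < i then Quandle.tri (x (i.succAbove l)) (x i) else x (i.succAbove l)

/-- The (action) rack space `B(X, Y)` of a quandle `X` and a right `As(X)`-set `Y`: the space glued
from the cubes `{y} × ∏_i ([0,1] × {x_i})`, where the face `t_i = 0` of `(y, x_1, …, x_n)` is
`(y, x_1, …, x_{i-1}, x_{i+1}, …, x_n)` and the face `t_i = 1` is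
`(y · e_{x_i}, x_1 ◁ x_i, …, x_{i-1} ◁ x_i, x_{i+1}, …, x_n)`. -/
abbrev actionRackSpace (Y : Type u) [MulAction (AssociatedGroup X)ᵐᵒᵖ Y] : PrecubicalSet.{u} where
  cell n := Y × (Fin n → X)
  face ε i c := match ε with
    | false => (c.1, fun l => c.2 (i.succAbove l))
    | true => (MulOpposite.op (AssociatedGroup.e (c.2 i)) • c.1, Quandle.actDelete i c.2)
  face_face := by
    intro n ε η i j hij c
    obtain ⟨y, x⟩ := c
    have hij' : (i : ℕ) ≤ j := hij
    have h1 : j.succ.succAbove i = i.castSucc :=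
      Fin.succAbove_of_castSucc_lt _ _ (by rw [Fin.lt_def, Fin.val_castSucc, Fin.val_succ]; omega)
    have h2 : i.castSucc.succAbove j = j.succ :=
      Fin.succAbove_of_le_castSucc _ _ (by rw [Fin.le_def, Fin.val_castSucc, Fin.val_castSucc]; exact hij')
    have h3 : ∀ l : Fin n, j.succ.succAbove (i.succAbove l) = i.castSucc.succAbove (j.succAbove l) := by
      intro l
      ext
      simp only [Fin.succAbove, Fin.lt_def]
      split_ifs <;> simp_all <;> omega
    have h4 : ∀ l : Fin n, ((i.succAbove l).castSucc < j.succ ↔ l.castSucc < j) := by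
      intro l
      simp only [Fin.succAbove, Fin.lt_def]
      split_ifs <;> simp_all <;> omega
    have h5 : ∀ l : Fin n, ((j.succAbove l).castSucc < i.castSucc ↔ l.castSucc < i) := by
      intro l
      simp only [Fin.succAbove, Fin.lt_def]
      split_ifs <;> simp_all <;> omega
    have h6 : i.castSucc < j.succ := by
      rw [Fin.lt_def, Fin.val_castSucc, Fin.val_succ]; omega
    have h7 : ¬ (j.castSucc < i.castSucc) := by
      rw [Fin.lt_def, Fin.val_castSucc, Fin.val_castSucc]; omega
    have h8 : ∀ l : Fin n, l.castSucc < i → l.castSucc < j := fun l h => lt_of_lt_of_le h hij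
    refine Prod.ext ?_ (funext fun l => ?_)
    · cases ε <;> cases η <;>
        simp only [Quandle.actDelete, h1, h2, h6, h7, if_true, if_false, smul_smul,
          ← MulOpposite.op_mul]
      rw [← AssociatedGroup.e_mul_e]
    · cases ε <;> cases η <;>
        simp only [Quandle.actDelete, h1, h2, h3, h4, h5, h6, h7, if_true, if_false]
      by_cases ha : l.castSucc < i
      · simp only [ha, h8 l ha, if_true, ← Quandle.tri_tri]
      · simp only [ha, if_false]

/-- The rack space `BX`, i.e. `B(X, Y)` with `Y` a single point. -/
abbrev rackSpace : PrecubicalSet.{u} := actionRackSpace X PUnit.{u + 1}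

/-- The universal covering `B(X, As(X)) → BX` of the rack space. The group
`As(X) = π_1(BX)` of deck transformations acts on it by left multiplication on the first entry. -/
abbrev rackSpaceCover : PrecubicalSet.{u} := actionRackSpace X (AssociatedGroup X)

end RackSpace

/-! ### The classifying map of the rack space -/

section Classifying

variable (k : Type u) [CommRing k]

/-- The boundary `(g_0, …, g_n) ↦ ∑_i (-1)^i (g_0, …, ĝ_i, …, g_n)` of the homogeneous standard
complex of `G`, i.e. of the simplicial chain complex of the universal covering `EG` of
`K(G, 1) = BG`. -/
def standardBoundary (G : Type u) (n : ℕ) :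
    ((Fin (n + 2) → G) →₀ k) →ₗ[k] ((Fin (n + 1) → G) →₀ k) :=
  Finsupp.linearCombination k fun g => ∑ i : Fin (n + 2),
    Finsupp.single (fun l => g (i.succAbove l)) ((-1 : k) ^ (i : ℕ))

/-- The augmentation of a free module: the sum of the coefficients. -/
def augmentation (S : Type u) : (S →₀ k) →ₗ[k] k := Finsupp.linearCombination k fun _ => (1 : k)

variable (X : Type u) [Quandle X]

/-- An `As(X)`-equivariant, augmentation-preserving chain map from the cellular chain complex of
the universal covering of `BX` to the standard resolution of `As(X)`, i.e. a map on chains covering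
a classifying map `c : BX → K(As(X), 1)` that is the identity on `π_1(BX) = As(X)`.
Such chain maps exist and any two of them are equivariantly chain homotopic, because the source is
free over the group ring and the target is acyclic. -/
structure ClassifyingLift where
  map : ∀ n : ℕ, ((rackSpaceCover X).cell n →₀ k) →ₗ[k] ((Fin (n + 1) → AssociatedGroup X) →₀ k)
  map_boundary : ∀ (n : ℕ) (z : (rackSpaceCover X).cell (n + 1) →₀ k),
    map n ((rackSpaceCover X).boundary k n z) =
      standardBoundary k (AssociatedGroup X) n (map (n + 1) z)
  equivariant : ∀ (n : ℕ) (g h : AssociatedGroup X) (x : Fin n → X),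
    map n (Finsupp.single (g * h, x) 1) =
      Finsupp.mapDomain (fun a l => g * a l) (map n (Finsupp.single (h, x) 1))
  map_augmentation : ∀ z : (rackSpaceCover X).cell 0 →₀ k,
    augmentation k _ (map 0 z) = augmentation k _ z

namespace ClassifyingLift

/-- The contraction `(g_1, …, g_n) ↦ (1, g_1, …, g_n)` of the homogeneous standard complex. -/
def cone (G : Type u) [Group G] (n : ℕ) : ((Fin n → G) →₀ k) →ₗ[k] ((Fin (n + 1) → G) →₀ k) :=
  Finsupp.lmapDomain k k fun g => Fin.cons 1 g

/-- Left translation on the homogeneous standard complex. -/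
def translate {G : Type u} [Group G] (g : G) (n : ℕ) :
    ((Fin n → G) →₀ k) →ₗ[k] ((Fin n → G) →₀ k) :=
  Finsupp.lmapDomain k k fun a l => g * a l

theorem standardBoundary_translate {G : Type u} [Group G] (g : G) (n : ℕ)
    (z : (Fin (n + 2) → G) →₀ k) :
    standardBoundary k G n (translate k g _ z) = translate k g _ (standardBoundary k G n z) := by
  suffices h : standardBoundary k G n ∘ₗ translate k g _ =
      translate k g _ ∘ₗ standardBoundary k G n from LinearMap.congr_fun h z
  refine Finsupp.lhom_ext' fun c => LinearMap.ext_ring ?_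
  simp [standardBoundary, translate, Finsupp.mapDomain_single]

theorem translate_mul {G : Type u} [Group G] (g h : G) (n : ℕ) (z : (Fin n → G) →₀ k) :
    translate k (g * h) n z = translate k g n (translate k h n z) := by
  simp only [translate, Finsupp.lmapDomain_apply, ← Finsupp.mapDomain_comp]
  congr 1
  funext a l
  simp [mul_assoc]

theorem standardBoundary_cone (G : Type u) [Group G] (n : ℕ) (z : (Fin (n + 2) → G) →₀ k) :
    standardBoundary k G (n + 1) (cone k G _ z) = z - cone k G _ (standardBoundary k G n z) := by
  suffices h : standardBoundary k G (n + 1) ∘ₗ cone k G _ =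
      LinearMap.id - cone k G _ ∘ₗ standardBoundary k G n from LinearMap.congr_fun h z
  refine Finsupp.lhom_ext' fun c => LinearMap.ext_ring ?_
  simp only [LinearMap.comp_apply, Finsupp.lsingle_apply, LinearMap.sub_apply, LinearMap.id_apply,
    standardBoundary, cone, Finsupp.lmapDomain_apply, Finsupp.mapDomain_single,
    Finsupp.linearCombination_single, one_smul]
  rw [Fin.sum_univ_succ, Finsupp.mapDomain_finsetSum, sub_eq_add_neg, ← Finset.sum_neg_distrib]
  congr 1
  · simp
  · refine Finset.sum_congr rfl fun i _ => ?_
    rw [Finsupp.mapDomain_single, ← Finsupp.single_neg, Fin.val_succ, pow_succ, mul_neg_one]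
    congr 1
    funext l
    refine Fin.cases ?_ (fun l => ?_) l <;> simp

theorem standardBoundary_cone_zero (G : Type u) [Group G] (z : (Fin 1 → G) →₀ k) :
    standardBoundary k G 0 (cone k G _ z) =
      z - augmentation k _ z • Finsupp.single (fun _ => 1) 1 := by
  suffices h : standardBoundary k G 0 ∘ₗ cone k G _ =
      LinearMap.id - (augmentation k _).smulRight (Finsupp.single (fun _ => 1) 1) from
    LinearMap.congr_fun h z
  refine Finsupp.lhom_ext' fun c => LinearMap.ext_ring ?_
  simp only [LinearMap.comp_apply, Finsupp.lsingle_apply, LinearMap.sub_apply, LinearMap.id_apply,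
    standardBoundary, cone, Finsupp.lmapDomain_apply, Finsupp.mapDomain_single,
    Finsupp.linearCombination_single, one_smul, LinearMap.smulRight_apply, augmentation]
  rw [Fin.sum_univ_succ, Fin.sum_univ_succ, sub_eq_add_neg, ← Finsupp.single_neg]
  have h : (fun l : Fin 1 => (Fin.cons 1 c : Fin 2 → G) (Fin.succAbove 1 l)) = fun _ => 1 := by
    funext l
    rw [Subsingleton.elim l 0]
    rfl
  simp [h]

/-- A classifying lift built from the contraction of the standard complex. -/
def standardMap : ∀ n : ℕ,
    ((rackSpaceCover X).cell n →₀ k) →ₗ[k] ((Fin (n + 1) → AssociatedGroup X) →₀ k)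
  | 0 => Finsupp.linearCombination k fun c => Finsupp.single (fun _ => c.1) 1
  | n + 1 => Finsupp.linearCombination k fun c =>
      translate k c.1 _ (cone k _ _ (standardMap n
        ((rackSpaceCover X).boundary k n (Finsupp.single (1, c.2) 1))))

theorem standardMap_translate (n : ℕ) (g h : AssociatedGroup X) (x : Fin n → X) :
    standardMap k X n (Finsupp.single (g * h, x) 1) =
      translate k g _ (standardMap k X n (Finsupp.single (h, x) 1)) := by
  cases n with
  | zero => simp [standardMap, translate, Finsupp.mapDomain_single]
  | succ n =>
    simp only [standardMap, Finsupp.linearCombination_single, one_smul]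
    exact translate_mul k g h _ _

theorem standardMap_boundary_single (n : ℕ) (g : AssociatedGroup X) (x : Fin (n + 1) → X) :
    standardMap k X n ((rackSpaceCover X).boundary k n (Finsupp.single (g, x) 1)) =
      translate k g _ (standardMap k X n
        ((rackSpaceCover X).boundary k n (Finsupp.single (1, x) 1))) := by
  rw [PrecubicalSet.boundary_single, PrecubicalSet.boundary_single]
  simp only [map_sum, map_smul, map_sub]
  refine Finset.sum_congr rfl fun i _ => ?_
  congr 2
  · exact standardMap_translate k X n g _ _ ▸ by simp
  · rw [← standardMap_translate, mul_one]

theorem standardMap_boundary (n : ℕ) (z : (rackSpaceCover X).cell (n + 1) →₀ k) :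
    standardMap k X n ((rackSpaceCover X).boundary k n z) =
      standardBoundary k (AssociatedGroup X) n (standardMap k X (n + 1) z) := by
  induction n with
  | zero =>
    suffices h : standardMap k X 0 ∘ₗ (rackSpaceCover X).boundary k 0 =
        standardBoundary k _ 0 ∘ₗ standardMap k X 1 from LinearMap.congr_fun h z
    refine Finsupp.lhom_ext' fun c => LinearMap.ext_ring ?_
    obtain ⟨g, x⟩ := c
    simp only [LinearMap.comp_apply, Finsupp.lsingle_apply]
    rw [standardMap_boundary_single]
    conv_rhs => rw [standardMap, Finsupp.linearCombination_single, one_smul,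
      standardBoundary_translate, standardBoundary_cone_zero]
    congr 1
    rw [eq_comm, sub_eq_self]
    convert zero_smul k _
    rw [PrecubicalSet.boundary_single]
    simp [standardMap, augmentation]
  | succ n ih =>
    suffices h : standardMap k X (n + 1) ∘ₗ (rackSpaceCover X).boundary k (n + 1) =
        standardBoundary k _ (n + 1) ∘ₗ standardMap k X (n + 2) from LinearMap.congr_fun h z
    refine Finsupp.lhom_ext' fun c => LinearMap.ext_ring ?_
    obtain ⟨g, x⟩ := c
    simp only [LinearMap.comp_apply, Finsupp.lsingle_apply]
    rw [standardMap_boundary_single]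
    conv_rhs => rw [standardMap, Finsupp.linearCombination_single, one_smul,
      standardBoundary_translate, standardBoundary_cone, ← ih]
    have h0 := LinearMap.congr_fun ((rackSpaceCover X).boundary_boundary k n)
      (Finsupp.single (1, x) 1)
    simp only [LinearMap.comp_apply, LinearMap.zero_apply] at h0
    rw [h0, map_zero, map_zero, sub_zero]

/-- Classifying lifts exist. -/
instance : Nonempty (ClassifyingLift k X) :=
  ⟨{ map := standardMap k X
     map_boundary := standardMap_boundary k X
     equivariant := standardMap_translate k X
     map_augmentation := fun z => by
      suffices h : augmentation k _ ∘ₗ standardMap k X 0 = augmentation k _ from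
        LinearMap.congr_fun h z
      refine Finsupp.lhom_ext' fun c => LinearMap.ext_ring ?_
      simp [standardMap, augmentation] }⟩

end ClassifyingLift

/-- The projection from the homogeneous standard complex to inhomogeneous chains, identifying the
latter with the coinvariants: `(g_0, …, g_n) ↦ (g_0⁻¹ g_1, …, g_{n-1}⁻¹ g_n)`. -/
def toInhomogeneous (G : Type u) [Group G] (n : ℕ) :
    ((Fin (n + 1) → G) →₀ k) →ₗ[k] ((Fin n → G) →₀ k) :=
  Finsupp.lmapDomain k k fun g l => (g l.castSucc)⁻¹ * g l.succ

theorem toInhomogeneous_single (G : Type u) [Group G] (n : ℕ) (g : Fin (n + 1) → G) (r : k) :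
    toInhomogeneous k G n (Finsupp.single g r) =
      Finsupp.single (fun l => (g l.castSucc)⁻¹ * g l.succ) r := by
  simp [toInhomogeneous, Finsupp.mapDomain_single]

theorem toInhomogeneous_translate (G : Type u) [Group G] (n : ℕ) (g : G)
    (z : (Fin (n + 1) → G) →₀ k) :
    toInhomogeneous k G n (Finsupp.mapDomain (fun a l => g * a l) z) =
      toInhomogeneous k G n z := by
  simp only [toInhomogeneous, Finsupp.lmapDomain_apply, ← Finsupp.mapDomain_comp]
  congr 1
  funext a l
  simp [mul_assoc]

theorem toInhomogeneous_boundary (G : Type u) [Group G] (n : ℕ) (z : (Fin (n + 2) → G) →₀ k) :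
    toInhomogeneous k G n (standardBoundary k G n z) =
      (groupHomology.inhomogeneousChains.d (Rep.trivial k G k) n).hom
        (toInhomogeneous k G (n + 1) z) := by
  suffices h : toInhomogeneous k G n ∘ₗ standardBoundary k G n =
      (groupHomology.inhomogeneousChains.d (Rep.trivial k G k) n).hom ∘ₗ
        toInhomogeneous k G (n + 1) from LinearMap.congr_fun h z
  refine Finsupp.lhom_ext' fun g => LinearMap.ext_ring ?_
  have hd := groupHomology.inhomogeneousChains.d_single (A := Rep.trivial k G k) n
    (fun l => (g l.castSucc)⁻¹ * g l.succ) (1 : k)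
  simp only [LinearMap.comp_apply, Finsupp.lsingle_apply, toInhomogeneous_single]
  refine Eq.trans ?_ hd.symm
  rw [standardBoundary, Finsupp.linearCombination_single, one_smul, map_sum, Fin.sum_univ_succ]
  simp only [toInhomogeneous_single]
  congr 1
  · simp
  · refine Finset.sum_congr rfl fun j _ => ?_
    rw [Finsupp.smul_single, smul_eq_mul, mul_one]
    congr 1
    funext l
    have hg : ∀ m, g m = g 0 * Fin.partialProd (fun l => (g l.castSucc)⁻¹ * g l.succ) m :=
      fun m => (congrFun (Fin.partialProd_left_inv g) m).symm
    rw [← Fin.inv_partialProd_mul_eq_contractNth, hg (j.succ.succAbove l.castSucc),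
      hg (j.succ.succAbove l.succ), Fin.succ_succAbove_succ]
    simp [mul_assoc]

theorem ClassifyingLift.toInhomogeneous_map {k : Type u} [CommRing k] {X : Type u} [Quandle X]
    (φ : ClassifyingLift k X) (n : ℕ) (g : AssociatedGroup X) (x : Fin n → X) :
    toInhomogeneous k _ n (φ.map n (Finsupp.single (g, x) 1)) =
      toInhomogeneous k _ n (φ.map n (Finsupp.single (1, x) 1)) := by
  conv_lhs => rw [← mul_one g, φ.equivariant, toInhomogeneous_translate]

/-- The map on `n`-chains induced on coinvariants by a classifying lift: the cell `(x_1, …, x_n)` of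
`BX` is lifted to the cell `(1, x_1, …, x_n)` of the covering. -/
def ClassifyingLift.chainMap {k : Type u} [CommRing k] {X : Type u} [Quandle X]
    (φ : ClassifyingLift k X) (n : ℕ) :
    ((rackSpace X).cell n →₀ k) →ₗ[k] ((Fin n → AssociatedGroup X) →₀ k) :=
  Finsupp.linearCombination k fun c =>
    toInhomogeneous k _ n (φ.map n (Finsupp.single (1, c.2) 1))

theorem ClassifyingLift.chainMap_single {k : Type u} [CommRing k] {X : Type u} [Quandle X]
    (φ : ClassifyingLift k X) (n : ℕ) (c : (rackSpace X).cell n) (g : AssociatedGroup X) :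
    φ.chainMap n (Finsupp.single c 1) =
      toInhomogeneous k _ n (φ.map n (Finsupp.single (g, c.2) 1)) := by
  rw [φ.toInhomogeneous_map, chainMap, Finsupp.linearCombination_single, one_smul]

theorem ClassifyingLift.chainMap_boundary {k : Type u} [CommRing k] {X : Type u} [Quandle X]
    (φ : ClassifyingLift k X) (n : ℕ) (z : (rackSpace X).cell (n + 1) →₀ k) :
    φ.chainMap n ((rackSpace X).boundary k n z) =
      (groupHomology.inhomogeneousChains.d (Rep.trivial k (AssociatedGroup X) k) n).hom
        (φ.chainMap (n + 1) z) := by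
  suffices h : φ.chainMap n ∘ₗ (rackSpace X).boundary k n =
      (groupHomology.inhomogeneousChains.d (Rep.trivial k (AssociatedGroup X) k) n).hom ∘ₗ
        φ.chainMap (n + 1) from LinearMap.congr_fun h z
  refine Finsupp.lhom_ext' fun c => LinearMap.ext_ring ?_
  simp only [LinearMap.comp_apply, Finsupp.lsingle_apply]
  rw [φ.chainMap_single (n + 1) c 1, ← toInhomogeneous_boundary, ← φ.map_boundary,
    PrecubicalSet.boundary_single, (rackSpaceCover X).boundary_single k n (1, c.2)]
  simp only [map_sum, map_smul, map_sub]
  refine Finset.sum_congr rfl fun i _ => ?_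
  congr 2
  · exact φ.chainMap_single n _ _
  · exact φ.chainMap_single n _ _

/-- The chain map from the cellular chain complex of `BX` to the (inhomogeneous) chain complex
computing the group homology of `As(X)` with trivial coefficients. -/
def ClassifyingLift.toChainMap {k : Type u} [CommRing k] {X : Type u} [Quandle X]
    (φ : ClassifyingLift k X) :
    (rackSpace X).cellularComplex k ⟶
      groupHomology.inhomogeneousChains (Rep.trivial k (AssociatedGroup X) k) :=
  ChainComplex.ofHom (fun n => ModuleCat.ofHom (φ.chainMap n)) (fun n => by
    rw [groupHomology.inhomogeneousChains.d_def, PrecubicalSet.cellularComplex_d]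
    refine ModuleCat.hom_ext (LinearMap.ext fun z => ?_)
    exact (φ.chainMap_boundary n z).symm)

/-- The map `c_* : H_n(BX) → H_n^gr(As(X))` induced by the classifying map. -/
def ClassifyingLift.homologyMap {k : Type u} [CommRing k] {X : Type u} [Quandle X]
    (φ : ClassifyingLift k X) (n : ℕ) :
    ((rackSpace X).cellularComplex k).homology n ⟶
      groupHomology (Rep.trivial k (AssociatedGroup X) k) n :=
  HomologicalComplex.homologyMap φ.toChainMap n

end Classifying

end

/-!
The map `c_*` does not depend on the classifying lift, since any two lifts are equivariantly
homotopic (`ClassifyingLift.exists_chainMap_sub_eq`). It is therefore enough to treat one convenient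
lift, `prismLift`, built from prism operators. On the inhomogeneous chains of a group `G` the
operator `P_g` (`barPrism`) satisfies `d P_g + P_g d = R_g - 1`, where `R_g` is conjugation by `g`,
and `R_h P_g = P_{h⁻¹gh} R_h`. In the rack space the two faces of `(x_1, …, x_n, a)` in the last
direction are `(x_1, …, x_n)` and `(x_1 ◁ a, …, x_n ◁ a)`, and passing from the former to the latter
corresponds to conjugation by `e_a`. Hence `c(x_1, …, x_n, a) = ± P_{e_a} c(x_1, …, x_n)` defines a
chain map (`chainMap_prismLift_tack`).

If `X` is connected of type `t`, then `e_x ^ t` is central and independent of `x`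
(`AssociatedGroup.e_pow_eq_e_pow`). The chain `h(x) = ∑_{j < t} (e_x, e_x^j)` (`powerChain`) has
boundary `t (e_x) + (1) - (e_x ^ t)`, so up to a constant cycle `t c` is a boundary in degree one.
Geometrically, `t` copies of the square `(x, a)` become the torus spanned by the central element
`e_a ^ t` and `e_a`. This torus bounds, because `e_a ^ t` is a power of `e_a` and the torus
spanned by `e_a` and `e_a` is degenerate (`barPrism_self`). Explicitly, with `H_1 = -h`,
`H_2(x, a) = P_{e_a}(h(x) - h(a))` and `H_{n+1}(x_1, …, x_n, a) = ± P_{e_a} H_n(x_1, …, x_n)`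
for `n ≥ 2` (`nullHomotopy`), one has `t c_n = d H_n + H_{n-1} ∂` for every `n ≥ 2`
(`smul_chainMap_prismLift`).
-/

noncomputable section

/-! ### The prism operator on simplicial chains -/

section Prism

variable (k : Type u) [CommRing k] {S : Type u}

/-- The map induced on chains of tuples by a map of vertices. -/
def pushTuple {S' : Type u} (r : S → S') (n : ℕ) :
    ((Fin n → S) →₀ k) →ₗ[k] ((Fin n → S') →₀ k) :=
  Finsupp.lmapDomain k k fun a => r ∘ a

/-- The join with a vertex `s`, namely `(a_1, …, a_n) ↦ (s, a_1, …, a_n)`. -/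
def prepend (s : S) (n : ℕ) : ((Fin n → S) →₀ k) →ₗ[k] ((Fin (n + 1) → S) →₀ k) :=
  Finsupp.lmapDomain k k fun a => (Fin.cons s a : Fin (n + 1) → S)

variable (S) in
/-- The boundary of the full simplex on `S`, in the augmented indexing: tuples of length `n + 1` are
sent to tuples of length `n`, so that `n = 0` is the augmentation. -/
def tupleBoundary (n : ℕ) : ((Fin (n + 1) → S) →₀ k) →ₗ[k] ((Fin n → S) →₀ k) :=
  Finsupp.linearCombination k fun g => ∑ i : Fin (n + 1),
    Finsupp.single (fun l => g (i.succAbove l)) ((-1 : k) ^ (i : ℕ))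

theorem standardBoundary_eq_tupleBoundary (G : Type u) (n : ℕ) :
    standardBoundary k G n = tupleBoundary k G (n + 1) := rfl

/-- The prism operator of a map `r : S → S`:
`(a_1, …, a_n) ↦ ∑_i (-1)^(i-1) (a_1, …, a_i, r a_i, …, r a_n)`, defined by splitting off the first
vertex. -/
def prism (r : S → S) : ∀ n : ℕ, ((Fin n → S) →₀ k) →ₗ[k] ((Fin (n + 1) → S) →₀ k)
  | 0 => 0
  | n + 1 => Finsupp.linearCombination k fun a =>
      prepend k (a 0) (n + 1) (Finsupp.single (r ∘ a) 1) -
        prepend k (a 0) (n + 1) (prism r n (Finsupp.single (Fin.tail a) 1))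

variable {k}

@[simp]
theorem pushTuple_single {S' : Type u} (r : S → S') (n : ℕ) (a : Fin n → S) (c : k) :
    pushTuple k r n (Finsupp.single a c) = Finsupp.single (r ∘ a) c := by
  simp [pushTuple]

@[simp]
theorem prepend_single (s : S) (n : ℕ) (a : Fin n → S) (c : k) :
    prepend k s n (Finsupp.single a c) = Finsupp.single (Fin.cons s a : Fin (n + 1) → S) c := by
  simp [prepend]

/-- Linear maps on chains of nonempty tuples are determined by their values on joins. -/
theorem prepend_hom_ext {n : ℕ} {V : Type*} [AddCommGroup V] [Module k V]
    {f g : ((Fin (n + 1) → S) →₀ k) →ₗ[k] V}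
    (h : ∀ s z, f (prepend k s n z) = g (prepend k s n z)) : f = g := by
  refine Finsupp.lhom_ext' fun a => LinearMap.ext_ring ?_
  simpa using h (a 0) (Finsupp.single (Fin.tail a) 1)

theorem pushTuple_prepend {S' : Type u} (f : S → S') (s : S) (n : ℕ) (z : (Fin n → S) →₀ k) :
    pushTuple k f (n + 1) (prepend k s n z) = prepend k (f s) n (pushTuple k f n z) := by
  suffices h : pushTuple k f (n + 1) ∘ₗ prepend k s n =
      prepend k (f s) n ∘ₗ pushTuple k f n from LinearMap.congr_fun h z
  refine Finsupp.lhom_ext' fun a => LinearMap.ext_ring ?_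
  simp [Fin.comp_cons]

theorem tupleBoundary_prepend (s : S) (n : ℕ) (z : (Fin (n + 1) → S) →₀ k) :
    tupleBoundary k S (n + 1) (prepend k s _ z) = z - prepend k s _ (tupleBoundary k S n z) := by
  suffices h : tupleBoundary k S (n + 1) ∘ₗ prepend k s _ =
      LinearMap.id - prepend k s _ ∘ₗ tupleBoundary k S n from LinearMap.congr_fun h z
  refine Finsupp.lhom_ext' fun c => LinearMap.ext_ring ?_
  simp only [LinearMap.comp_apply, Finsupp.lsingle_apply, LinearMap.sub_apply, LinearMap.id_apply,
    tupleBoundary, prepend_single, Finsupp.linearCombination_single, one_smul, map_sum]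
  rw [Fin.sum_univ_succ, sub_eq_add_neg, ← Finset.sum_neg_distrib]
  congr 1
  · simp
  · refine Finset.sum_congr rfl fun i _ => ?_
    rw [← Finsupp.single_neg, Fin.val_succ, pow_succ, mul_neg_one]
    congr 1
    funext l
    refine Fin.cases ?_ (fun l => ?_) l <;> simp

theorem tupleBoundary_pushTuple (r : S → S) (n : ℕ) (z : (Fin (n + 1) → S) →₀ k) :
    tupleBoundary k S n (pushTuple k r _ z) = pushTuple k r _ (tupleBoundary k S n z) := by
  suffices h : tupleBoundary k S n ∘ₗ pushTuple k r _ =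
      pushTuple k r _ ∘ₗ tupleBoundary k S n from LinearMap.congr_fun h z
  refine Finsupp.lhom_ext' fun c => LinearMap.ext_ring ?_
  simp [tupleBoundary, Function.comp_def]

theorem prism_prepend (r : S → S) (s : S) (n : ℕ) (z : (Fin n → S) →₀ k) :
    prism k r (n + 1) (prepend k s n z) =
      prepend k s _ (pushTuple k r _ (prepend k s n z)) - prepend k s _ (prism k r n z) := by
  suffices h : prism k r (n + 1) ∘ₗ prepend k s n =
      prepend k s _ ∘ₗ pushTuple k r _ ∘ₗ prepend k s n - prepend k s _ ∘ₗ prism k r n from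
    LinearMap.congr_fun h z
  refine Finsupp.lhom_ext' fun a => LinearMap.ext_ring ?_
  simp [prism]

/-- The prism operator is a homotopy from the identity to the map induced by `r`. -/
theorem tupleBoundary_prism (r : S → S) (n : ℕ) (z : (Fin (n + 1) → S) →₀ k) :
    tupleBoundary k S (n + 1) (prism k r (n + 1) z) =
      pushTuple k r _ z - z - prism k r n (tupleBoundary k S n z) := by
  suffices h : tupleBoundary k S (n + 1) ∘ₗ prism k r (n + 1) =
      pushTuple k r _ - LinearMap.id - prism k r n ∘ₗ tupleBoundary k S n from
    LinearMap.congr_fun h z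
  clear z
  induction n with
  | zero =>
    refine prepend_hom_ext fun s z => ?_
    simp only [LinearMap.comp_apply, LinearMap.sub_apply, LinearMap.id_apply, prism_prepend,
      map_sub, tupleBoundary_prepend, pushTuple_prepend]
    -- Tuples of length zero are all equal, so the join with `r s` has boundary `z` itself.
    have h0 : tupleBoundary k S 0 (prepend k (r s) 0 (pushTuple k r 0 z)) = z := by
      suffices h : tupleBoundary k S 0 ∘ₗ prepend k (r s) 0 ∘ₗ pushTuple k r 0 = LinearMap.id from
        LinearMap.congr_fun h z
      refine Finsupp.lhom_ext' fun a => LinearMap.ext_ring ?_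
      simp only [LinearMap.comp_apply, Finsupp.lsingle_apply, pushTuple_single, prepend_single,
        tupleBoundary, Finsupp.linearCombination_single]
      simp
    rw [h0]
    simp [prism]
  | succ n ih =>
    refine prepend_hom_ext fun s z => ?_
    have ih' := LinearMap.congr_fun ih z
    simp only [LinearMap.comp_apply, LinearMap.sub_apply, LinearMap.id_apply] at ih' ⊢
    simp only [prism_prepend, map_sub, tupleBoundary_prepend, pushTuple_prepend, ih',
      tupleBoundary_pushTuple]
    abel

/-- Prism operators are natural for maps of vertices. -/
theorem pushTuple_prism {f r r' : S → S} (h : f ∘ r = r' ∘ f) (n : ℕ) (z : (Fin n → S) →₀ k) :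
    pushTuple k f _ (prism k r n z) = prism k r' n (pushTuple k f _ z) := by
  suffices h : pushTuple k f _ ∘ₗ prism k r n = prism k r' n ∘ₗ pushTuple k f _ from
    LinearMap.congr_fun h z
  clear z
  induction n with
  | zero => simp [prism]
  | succ n ih =>
    refine prepend_hom_ext fun s z => ?_
    have ih' := LinearMap.congr_fun ih z
    have hs : f (r s) = r' (f s) := congrFun h s
    have hp : pushTuple k f n (pushTuple k r n z) = pushTuple k r' n (pushTuple k f n z) := by
      simp only [pushTuple, Finsupp.lmapDomain_apply, ← Finsupp.mapDomain_comp]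
      congr 1
      funext a
      simp only [Function.comp_apply, ← Function.comp_assoc, h]
    simp only [LinearMap.comp_apply] at ih' ⊢
    simp only [prism_prepend, map_sub, pushTuple_prepend, ih', hs, hp]

end Prism

/-! ### Adjoining a last coordinate to the cubes of the rack space -/

theorem AssociatedGroup.e_tri {X : Type u} [Quandle X] (x y : X) :
    AssociatedGroup.e (Quandle.tri x y) =
      (AssociatedGroup.e y)⁻¹ * AssociatedGroup.e x * AssociatedGroup.e y := by
  rw [mul_assoc, AssociatedGroup.e_mul_e, inv_mul_cancel_left]

namespace RackChain

variable {k : Type u} [CommRing k] {X Y : Type u}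

/-- The map `(y; x_1, …, x_n) ↦ (y; x_1, …, x_n, a)` on cubical chains. -/
def tack (a : X) (n : ℕ) :
    ((Y × (Fin n → X)) →₀ k) →ₗ[k] ((Y × (Fin (n + 1) → X)) →₀ k) :=
  Finsupp.lmapDomain k k fun c => (c.1, (Fin.snoc c.2 a : Fin (n + 1) → X))

@[simp]
theorem tack_single (a : X) (n : ℕ) (c : Y × (Fin n → X)) (r : k) :
    tack a n (Finsupp.single c r) =
      Finsupp.single (c.1, (Fin.snoc c.2 a : Fin (n + 1) → X)) r := by
  simp [tack]

/-- Linear maps on chains of positive degree are determined by their values on the chains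
`tack a n z`. -/
theorem tack_hom_ext {n : ℕ} {V : Type*} [AddCommGroup V] [Module k V]
    {f g : ((Y × (Fin (n + 1) → X)) →₀ k) →ₗ[k] V}
    (h : ∀ a z, f (tack a n z) = g (tack a n z)) : f = g := by
  refine Finsupp.lhom_ext' fun c => LinearMap.ext_ring ?_
  simpa using h (c.2 (Fin.last n)) (Finsupp.single (c.1, Fin.init c.2) 1)

/-- The linear map on `(n + 1)`-chains that restricts to `F a` on the cubes with last coordinate
`a`. -/
def extend {n : ℕ} {V : Type*} [AddCommGroup V] [Module k V]
    (F : X → ((Y × (Fin n → X)) →₀ k) →ₗ[k] V) : ((Y × (Fin (n + 1) → X)) →₀ k) →ₗ[k] V :=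
  Finsupp.linearCombination k fun c =>
    F (c.2 (Fin.last n)) (Finsupp.single (c.1, Fin.init c.2) 1)

@[simp]
theorem extend_tack {n : ℕ} {V : Type*} [AddCommGroup V] [Module k V]
    (F : X → ((Y × (Fin n → X)) →₀ k) →ₗ[k] V) (a : X) (z : (Y × (Fin n → X)) →₀ k) :
    extend F (tack a n z) = F a z := by
  suffices h : extend F ∘ₗ tack a n = F a from LinearMap.congr_fun h z
  refine Finsupp.lhom_ext' fun c => LinearMap.ext_ring ?_
  simp [extend]

variable [Quandle X] [MulAction (AssociatedGroup X)ᵐᵒᵖ Y]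

/-- The right action of the generator `e_a` on cubical chains:
`(y; x_1, …, x_n) ↦ (y · e_a; x_1 ◁ a, …, x_n ◁ a)`. -/
def act (a : X) (n : ℕ) : ((Y × (Fin n → X)) →₀ k) →ₗ[k] ((Y × (Fin n → X)) →₀ k) :=
  Finsupp.lmapDomain k k fun c =>
    (MulOpposite.op (AssociatedGroup.e a) • c.1, fun l => Quandle.tri (c.2 l) a)

@[simp]
theorem act_single (a : X) (n : ℕ) (c : Y × (Fin n → X)) (r : k) :
    act a n (Finsupp.single c r) = Finsupp.single
      (MulOpposite.op (AssociatedGroup.e a) • c.1, fun l => Quandle.tri (c.2 l) a) r := by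
  simp [act]

theorem act_tack (a b : X) (n : ℕ) (z : (Y × (Fin n → X)) →₀ k) :
    act a (n + 1) (tack b n z) = tack (Quandle.tri b a) n (act a n z) := by
  suffices h : act a (n + 1) ∘ₗ tack b n = tack (Quandle.tri b a) n ∘ₗ act (k := k) (Y := Y) a n from
    LinearMap.congr_fun h z
  refine Finsupp.lhom_ext' fun c => LinearMap.ext_ring ?_
  simp only [LinearMap.comp_apply, Finsupp.lsingle_apply, tack_single, act_single]
  congr 2
  funext l
  refine Fin.lastCases ?_ (fun l => ?_) l <;> simp

variable (k X Y) in
/-- The cellular boundary of the action rack space. -/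
abbrev bd (n : ℕ) : ((Y × (Fin (n + 1) → X)) →₀ k) →ₗ[k] ((Y × (Fin n → X)) →₀ k) :=
  (actionRackSpace X Y).boundary k n

/-- The two faces in the last direction differ by the action of the last coordinate. -/
theorem bd_tack_zero (a : X) (z : (Y × (Fin 0 → X)) →₀ k) :
    bd k X Y 0 (tack a 0 z) = z - act a 0 z := by
  suffices h : bd k X Y 0 ∘ₗ tack a 0 = LinearMap.id - act a 0 from LinearMap.congr_fun h z
  refine Finsupp.lhom_ext' fun c => LinearMap.ext_ring ?_
  simp only [LinearMap.comp_apply, Finsupp.lsingle_apply, tack_single, LinearMap.sub_apply,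
    LinearMap.id_apply, act_single]
  rw [bd, PrecubicalSet.boundary_single]
  simp only [Fin.sum_univ_succ, Fin.sum_univ_zero, Fin.val_zero, zero_add, pow_one, add_zero,
    neg_smul, one_smul, neg_sub]
  congr 2
  · exact Prod.ext rfl (Subsingleton.elim _ _)
  · exact Prod.ext rfl (Subsingleton.elim _ _)

theorem bd_tack_succ (a : X) (n : ℕ) (z : (Y × (Fin (n + 1) → X)) →₀ k) :
    bd k X Y (n + 1) (tack a (n + 1) z) =
      tack a n (bd k X Y n z) + (-1 : k) ^ n • (act a (n + 1) z - z) := by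
  suffices h : bd k X Y (n + 1) ∘ₗ tack a (n + 1) =
      tack a n ∘ₗ bd k X Y n + (-1 : k) ^ n • (act a (n + 1) - LinearMap.id) from
    LinearMap.congr_fun h z
  refine Finsupp.lhom_ext' fun c => LinearMap.ext_ring ?_
  simp only [LinearMap.comp_apply, Finsupp.lsingle_apply, tack_single, LinearMap.sub_apply,
    LinearMap.add_apply, LinearMap.smul_apply, LinearMap.id_apply, act_single]
  rw [bd, PrecubicalSet.boundary_single, bd, PrecubicalSet.boundary_single, Fin.sum_univ_castSucc,
    map_sum]
  have hlt : ∀ l : Fin (n + 1), l.castSucc < Fin.last (n + 1) := fun l => Fin.castSucc_lt_last l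
  have hlast : ∀ i : Fin (n + 1), i.castSucc.succAbove (Fin.last n) = Fin.last (n + 1) :=
    fun i => Fin.succAbove_of_le_castSucc _ _ (Fin.castSucc_le_castSucc_iff.2 (Fin.le_last i))
  congr 1
  · refine Finset.sum_congr rfl fun i _ => ?_
    simp only [map_smul, map_sub, tack_single, Fin.val_castSucc]
    congr 3
    · simp only [Fin.snoc_castSucc]
      refine congrArg _ (funext fun l => ?_)
      refine Fin.lastCases ?_ (fun l => ?_) l
      · have h1 : ¬ (Fin.last n).castSucc < i.castSucc := by
          rw [Fin.lt_def, Fin.val_castSucc, Fin.val_castSucc, Fin.val_last]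
          omega
        simp [Quandle.actDelete, h1, hlast]
      · have h2 : l.castSucc.castSucc < i.castSucc ↔ l.castSucc < i := Iff.rfl
        simp [Quandle.actDelete, h2, Fin.castSucc_succAbove_castSucc]
    · refine congrArg _ (funext fun l => ?_)
      refine Fin.lastCases ?_ (fun l => ?_) l
      · simp [hlast]
      · simp [Fin.castSucc_succAbove_castSucc]
  · rw [Fin.val_last, pow_succ, pow_succ]
    simp only [mul_neg, mul_one, neg_neg]
    congr 3
    · refine Prod.ext (by simp) (funext fun l => ?_)
      simp only [Quandle.actDelete, Fin.succAbove_last, hlt, if_true, Fin.snoc_castSucc,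
        Fin.snoc_last]
    · refine Prod.ext rfl (funext fun l => ?_)
      simp only [Fin.succAbove_last, Fin.snoc_castSucc]

end RackChain

/-! ### The classifying lift given by iterated prisms -/

section PrismLift

open RackChain AssociatedGroup

variable (k : Type u) [CommRing k] (X : Type u) [Quandle X]

/-- The classifying lift sending `(g; x_1, …, x_n)` to the cube spanned by `g` and
`e_{x_1}, …, e_{x_n}`, triangulated as an iterated prism: the last coordinate contributes the prism
operator of right multiplication by `e_{x_n}`. The signs match the convention that the
face `t_n = 1` enters the cellular boundary with sign `(-1)^n`. -/
def prismMap : ∀ n : ℕ, ((rackSpaceCover X).cell n →₀ k) →ₗ[k]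
    ((Fin (n + 1) → AssociatedGroup X) →₀ k)
  | 0 => Finsupp.linearCombination k fun c => Finsupp.single (fun _ => c.1) 1
  | n + 1 => extend fun a => (-1 : k) ^ (n + 1) • (prism k (· * e a) (n + 1) ∘ₗ prismMap n)

variable {k X}

theorem prismMap_tack (a : X) (n : ℕ) (z : (AssociatedGroup X × (Fin n → X)) →₀ k) :
    prismMap k X (n + 1) (tack a n z) =
      (-1 : k) ^ (n + 1) • prism k (· * e a) (n + 1) (prismMap k X n z) := by
  rw [prismMap, extend_tack]
  rfl

/-- Equivariance for the right action of the generators, in which `e_a` acts on the labels by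
`x ↦ x ◁ a` and on the vertices by right multiplication. This identifies the two faces of a prism
with the two faces of a cube in its last direction. -/
theorem prismMap_act (a : X) (n : ℕ) (z : (AssociatedGroup X × (Fin n → X)) →₀ k) :
    prismMap k X n (act a n z) = pushTuple k (· * e a) (n + 1) (prismMap k X n z) := by
  suffices h : prismMap k X n ∘ₗ act a n = pushTuple k (· * e a) (n + 1) ∘ₗ prismMap k X n from
    LinearMap.congr_fun h z
  clear z
  induction n with
  | zero =>
    refine Finsupp.lhom_ext' fun c => LinearMap.ext_ring ?_
    simp only [LinearMap.comp_apply, Finsupp.lsingle_apply, act_single, prismMap,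
      Finsupp.linearCombination_single, one_smul, pushTuple_single]
    rfl
  | succ n ih =>
    refine tack_hom_ext fun b z => ?_
    have ih' := LinearMap.congr_fun ih z
    simp only [LinearMap.comp_apply] at ih' ⊢
    rw [act_tack, prismMap_tack, prismMap_tack, ih', map_smul,
      pushTuple_prism (r' := (· * e (Quandle.tri b a)))]
    funext x
    simp [e_tri, mul_assoc]

theorem tupleBoundary_prismMap (n : ℕ) (z : (AssociatedGroup X × (Fin (n + 1) → X)) →₀ k) :
    tupleBoundary k _ (n + 1) (prismMap k X (n + 1) z) =
      prismMap k X n (bd k X (AssociatedGroup X) n z) := by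
  suffices h : tupleBoundary k _ (n + 1) ∘ₗ prismMap k X (n + 1) =
      prismMap k X n ∘ₗ bd k X (AssociatedGroup X) n from LinearMap.congr_fun h z
  clear z
  induction n with
  | zero =>
    refine tack_hom_ext fun a z => ?_
    simp only [LinearMap.comp_apply]
    rw [prismMap_tack, map_smul, tupleBoundary_prism, bd_tack_zero, map_sub, prismMap_act]
    simp [prism]
  | succ n ih =>
    refine tack_hom_ext fun a z => ?_
    have ih' := LinearMap.congr_fun ih z
    simp only [LinearMap.comp_apply] at ih' ⊢
    rw [prismMap_tack, map_smul, tupleBoundary_prism, ih', bd_tack_succ, map_add, prismMap_tack,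
      map_smul, map_sub, prismMap_act, pow_succ, pow_succ]
    module

theorem prismMap_translate (n : ℕ) (g h : AssociatedGroup X) (x : Fin n → X) :
    prismMap k X n (Finsupp.single (g * h, x) 1) =
      pushTuple k (g * ·) (n + 1) (prismMap k X n (Finsupp.single (h, x) 1)) := by
  induction n with
  | zero =>
    simp only [prismMap, Finsupp.linearCombination_single, one_smul, pushTuple_single]
    rfl
  | succ n ih =>
    have hx : ∀ g' : AssociatedGroup X, (Finsupp.single (g', x) 1 : _ →₀ k) =
        tack (x (Fin.last n)) n (Finsupp.single (g', Fin.init x) 1) := by simp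
    rw [hx, hx, prismMap_tack, prismMap_tack, ih, map_smul,
      pushTuple_prism (r' := (· * e (x (Fin.last n))))]
    funext y
    simp [mul_assoc]

variable (k X) in
/-- The iterated prisms form a classifying lift. -/
def prismLift : ClassifyingLift k X where
  map := prismMap k X
  map_boundary n z := (tupleBoundary_prismMap n z).symm
  equivariant := prismMap_translate
  map_augmentation z := by
    suffices h : augmentation k _ ∘ₗ prismMap k X 0 = augmentation k _ from LinearMap.congr_fun h z
    refine Finsupp.lhom_ext' fun c => LinearMap.ext_ring ?_
    simp [prismMap, augmentation]

end PrismLift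

/-! ### Uniqueness of the classifying map on homology -/

namespace ClassifyingLift

open RackChain

variable {k : Type u} [CommRing k] {X : Type u} [Quandle X] (φ ψ : ClassifyingLift k X)

/-- The equivariant chain homotopy between two classifying lifts built from the contraction of the
standard complex. -/
def homotopyMap : ∀ n : ℕ,
    ((rackSpaceCover X).cell n →₀ k) →ₗ[k] ((Fin (n + 2) → AssociatedGroup X) →₀ k)
  | 0 => Finsupp.linearCombination k fun c => translate k c.1 _ (cone k _ _
      (φ.map 0 (Finsupp.single (1, c.2) 1) - ψ.map 0 (Finsupp.single (1, c.2) 1)))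
  | n + 1 => Finsupp.linearCombination k fun c => translate k c.1 _ (cone k _ _
      (φ.map (n + 1) (Finsupp.single (1, c.2) 1) - ψ.map (n + 1) (Finsupp.single (1, c.2) 1) -
        homotopyMap n ((rackSpaceCover X).boundary k n (Finsupp.single (1, c.2) 1))))

theorem homotopyMap_translate (n : ℕ) (g h : AssociatedGroup X) (x : Fin n → X) :
    homotopyMap φ ψ n (Finsupp.single (g * h, x) 1) =
      translate k g _ (homotopyMap φ ψ n (Finsupp.single (h, x) 1)) := by
  cases n <;>
    simp only [homotopyMap, Finsupp.linearCombination_single, one_smul] <;>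
    exact translate_mul k g h _ _

theorem map_single_eq_translate (n : ℕ) (g : AssociatedGroup X) (x : Fin n → X) :
    φ.map n (Finsupp.single (g, x) 1) = translate k g _ (φ.map n (Finsupp.single (1, x) 1)) := by
  conv_lhs => rw [← mul_one g, φ.equivariant]
  rfl

theorem homotopyMap_boundary_single (n : ℕ) (g : AssociatedGroup X) (x : Fin (n + 1) → X) :
    homotopyMap φ ψ n ((rackSpaceCover X).boundary k n (Finsupp.single (g, x) 1)) =
      translate k g _ (homotopyMap φ ψ n
        ((rackSpaceCover X).boundary k n (Finsupp.single (1, x) 1))) := by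
  rw [PrecubicalSet.boundary_single, PrecubicalSet.boundary_single]
  simp only [map_sum, map_smul, map_sub]
  refine Finset.sum_congr rfl fun i _ => ?_
  congr 2
  · exact homotopyMap_translate φ ψ n g _ _ ▸ by simp
  · rw [← homotopyMap_translate, mul_one]

theorem standardBoundary_homotopyMap_zero (z : (rackSpaceCover X).cell 0 →₀ k) :
    standardBoundary k _ 0 (homotopyMap φ ψ 0 z) = φ.map 0 z - ψ.map 0 z := by
  suffices h : standardBoundary k _ 0 ∘ₗ homotopyMap φ ψ 0 = φ.map 0 - ψ.map 0 from
    LinearMap.congr_fun h z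
  refine Finsupp.lhom_ext' fun c => LinearMap.ext_ring ?_
  obtain ⟨g, x⟩ := c
  simp only [LinearMap.comp_apply, Finsupp.lsingle_apply, LinearMap.sub_apply]
  rw [homotopyMap, Finsupp.linearCombination_single, one_smul, standardBoundary_translate,
    standardBoundary_cone_zero, map_sub (augmentation k _), φ.map_augmentation,
    ψ.map_augmentation, sub_self, zero_smul, sub_zero, map_sub, ← map_single_eq_translate,
    ← map_single_eq_translate]

theorem homotopyMap_succ_single (n : ℕ) (g : AssociatedGroup X) (x : Fin (n + 1) → X) :
    homotopyMap φ ψ (n + 1) (Finsupp.single (g, x) 1) = translate k g _ (cone k _ _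
      (φ.map (n + 1) (Finsupp.single (1, x) 1) - ψ.map (n + 1) (Finsupp.single (1, x) 1) -
        homotopyMap φ ψ n ((rackSpaceCover X).boundary k n (Finsupp.single (1, x) 1)))) := by
  rw [homotopyMap, Finsupp.linearCombination_single, one_smul]

theorem standardBoundary_homotopyMap_succ (n : ℕ) (z : (rackSpaceCover X).cell (n + 1) →₀ k) :
    standardBoundary k _ (n + 1) (homotopyMap φ ψ (n + 1) z) =
      φ.map (n + 1) z - ψ.map (n + 1) z -
        homotopyMap φ ψ n ((rackSpaceCover X).boundary k n z) := by
  suffices h : standardBoundary k _ (n + 1) ∘ₗ homotopyMap φ ψ (n + 1) =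
      φ.map (n + 1) - ψ.map (n + 1) - homotopyMap φ ψ n ∘ₗ (rackSpaceCover X).boundary k n from
    LinearMap.congr_fun h z
  clear z
  induction n with
  | zero =>
    refine Finsupp.lhom_ext' fun c => LinearMap.ext_ring ?_
    obtain ⟨g, x⟩ := c
    simp only [LinearMap.comp_apply, Finsupp.lsingle_apply, LinearMap.sub_apply]
    rw [homotopyMap_succ_single, standardBoundary_translate,
      standardBoundary_cone, map_sub (standardBoundary k _ 0), map_sub (standardBoundary k _ 0),
      ← φ.map_boundary, ← ψ.map_boundary, standardBoundary_homotopyMap_zero, sub_self, map_zero,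
      sub_zero, map_sub, map_sub, ← homotopyMap_boundary_single, ← map_single_eq_translate,
      ← map_single_eq_translate]
  | succ n ih =>
    refine Finsupp.lhom_ext' fun c => LinearMap.ext_ring ?_
    obtain ⟨g, x⟩ := c
    have h0 := LinearMap.congr_fun ((rackSpaceCover X).boundary_boundary k n)
      (Finsupp.single (1, x) 1)
    have ih' := LinearMap.congr_fun ih
      ((rackSpaceCover X).boundary k (n + 1) (Finsupp.single (1, x) 1))
    simp only [LinearMap.comp_apply, Finsupp.lsingle_apply, LinearMap.sub_apply,
      LinearMap.zero_apply] at h0 ih' ⊢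
    rw [h0, map_zero, sub_zero] at ih'
    rw [homotopyMap_succ_single, standardBoundary_translate,
      standardBoundary_cone, map_sub (standardBoundary k _ _), map_sub (standardBoundary k _ _),
      ← φ.map_boundary, ← ψ.map_boundary, ih', sub_self, map_zero,
      sub_zero, map_sub, map_sub, ← homotopyMap_boundary_single, ← map_single_eq_translate,
      ← map_single_eq_translate]

end ClassifyingLift

/-- The differential of the inhomogeneous chain complex of `G` with trivial coefficients. -/
abbrev barBoundary (k : Type u) [CommRing k] (G : Type u) [Group G] (n : ℕ) :
    ((Fin (n + 1) → G) →₀ k) →ₗ[k] ((Fin n → G) →₀ k) :=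
  (groupHomology.inhomogeneousChains.d (Rep.trivial k G k) n).hom

namespace RackChain

variable {k : Type u} [CommRing k] {X : Type u} [Quandle X]

variable (k X) in
/-- The map on chains induced by the covering `B(X, As(X)) → BX`. -/
def proj (n : ℕ) : ((AssociatedGroup X × (Fin n → X)) →₀ k) →ₗ[k]
    ((PUnit.{u + 1} × (Fin n → X)) →₀ k) :=
  Finsupp.lmapDomain k k fun c => (PUnit.unit, c.2)

@[simp]
theorem proj_single (n : ℕ) (c : AssociatedGroup X × (Fin n → X)) (r : k) :
    proj k X n (Finsupp.single c r) = Finsupp.single (PUnit.unit, c.2) r := by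
  simp [proj]

variable (k X) in
/-- The section of `proj` with values in the sheet of the unit element. -/
def unitSheet (n : ℕ) : ((PUnit.{u + 1} × (Fin n → X)) →₀ k) →ₗ[k]
    ((AssociatedGroup X × (Fin n → X)) →₀ k) :=
  Finsupp.lmapDomain k k fun c => (1, c.2)

theorem proj_unitSheet (n : ℕ) (z : (PUnit.{u + 1} × (Fin n → X)) →₀ k) :
    proj k X n (unitSheet k X n z) = z := by
  suffices h : proj k X n ∘ₗ unitSheet k X n = LinearMap.id from LinearMap.congr_fun h z
  refine Finsupp.lhom_ext' fun c => LinearMap.ext_ring ?_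
  simp [unitSheet]

/-- A linear map that does not see the sheet of a cell factors through `proj`. -/
theorem apply_unitSheet_proj {n : ℕ} {V : Type*} [AddCommGroup V] [Module k V]
    (F : ((AssociatedGroup X × (Fin n → X)) →₀ k) →ₗ[k] V)
    (hF : ∀ g x, F (Finsupp.single (g, x) 1) = F (Finsupp.single (1, x) 1))
    (z : (AssociatedGroup X × (Fin n → X)) →₀ k) :
    F (unitSheet k X n (proj k X n z)) = F z := by
  suffices h : F ∘ₗ unitSheet k X n ∘ₗ proj k X n = F from LinearMap.congr_fun h z
  refine Finsupp.lhom_ext' fun c => LinearMap.ext_ring ?_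
  simp [unitSheet, hF c.1 c.2]

theorem bd_proj (n : ℕ) (z : (AssociatedGroup X × (Fin (n + 1) → X)) →₀ k) :
    bd k X PUnit n (proj k X (n + 1) z) = proj k X n (bd k X (AssociatedGroup X) n z) := by
  suffices h : bd k X PUnit n ∘ₗ proj k X (n + 1) =
      proj k X n ∘ₗ bd k X (AssociatedGroup X) n from LinearMap.congr_fun h z
  refine Finsupp.lhom_ext' fun c => LinearMap.ext_ring ?_
  simp only [LinearMap.comp_apply, Finsupp.lsingle_apply, proj_single]
  rw [bd, PrecubicalSet.boundary_single, bd, PrecubicalSet.boundary_single, map_sum]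
  refine Finset.sum_congr rfl fun i _ => ?_
  rw [map_smul, map_sub, proj_single, proj_single]

theorem tack_proj (a : X) (n : ℕ) (z : (AssociatedGroup X × (Fin n → X)) →₀ k) :
    tack a n (proj k X n z) = proj k X (n + 1) (tack a n z) := by
  suffices h : tack a n ∘ₗ proj k X n = proj k X (n + 1) ∘ₗ tack a n from LinearMap.congr_fun h z
  refine Finsupp.lhom_ext' fun c => LinearMap.ext_ring ?_
  simp

end RackChain

namespace ClassifyingLift

open RackChain

variable {k : Type u} [CommRing k] {X : Type u} [Quandle X] (φ ψ : ClassifyingLift k X)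

theorem chainMap_proj (n : ℕ) (z : (AssociatedGroup X × (Fin n → X)) →₀ k) :
    φ.chainMap n (proj k X n z) = toInhomogeneous k _ n (φ.map n z) := by
  suffices h : φ.chainMap n ∘ₗ proj k X n = toInhomogeneous k _ n ∘ₗ φ.map n from
    LinearMap.congr_fun h z
  refine Finsupp.lhom_ext' fun c => LinearMap.ext_ring ?_
  simp only [LinearMap.comp_apply, Finsupp.lsingle_apply, proj_single]
  exact φ.chainMap_single n _ c.1

/-- On cycles of positive degree, two classifying lifts differ by a boundary. -/
theorem exists_chainMap_sub_eq (n : ℕ) (z : (PUnit.{u + 1} × (Fin (n + 1) → X)) →₀ k)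
    (hz : bd k X PUnit n z = 0) :
    ∃ w, φ.chainMap (n + 1) z - ψ.chainMap (n + 1) z = barBoundary k _ (n + 1) w := by
  refine ⟨toInhomogeneous k _ (n + 2) (homotopyMap φ ψ (n + 1) (unitSheet k X (n + 1) z)), ?_⟩
  have h1 : toInhomogeneous k _ (n + 1) (homotopyMap φ ψ n
      (bd k X (AssociatedGroup X) n (unitSheet k X (n + 1) z))) = 0 := by
    have hF : ∀ g x, (toInhomogeneous k _ (n + 1) ∘ₗ homotopyMap φ ψ n) (Finsupp.single (g, x) 1) =
        (toInhomogeneous k _ (n + 1) ∘ₗ homotopyMap φ ψ n) (Finsupp.single (1, x) 1) := by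
      intro g x
      simp only [LinearMap.comp_apply]
      conv_lhs => rw [← mul_one g, homotopyMap_translate]
      exact toInhomogeneous_translate k _ _ _ _
    have h2 := apply_unitSheet_proj (toInhomogeneous k _ (n + 1) ∘ₗ homotopyMap φ ψ n) hF
      (bd k X (AssociatedGroup X) n (unitSheet k X (n + 1) z))
    rw [← bd_proj, proj_unitSheet, hz, map_zero, map_zero] at h2
    exact h2.symm
  rw [barBoundary, ← toInhomogeneous_boundary, standardBoundary_homotopyMap_succ, map_sub, map_sub,
    ← chainMap_proj, ← chainMap_proj, proj_unitSheet]
  exact (sub_eq_self.2 h1).symm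

end ClassifyingLift

/-! ### The prism operator on inhomogeneous chains -/

section BarPrism

variable {k : Type u} [CommRing k] {G : Type u} [Group G]

variable (k G) in
/-- The section `(g_1, …, g_n) ↦ (1, g_1, g_1 g_2, …, g_1 ⋯ g_n)` of `toInhomogeneous`. -/
def toHomogeneous (n : ℕ) : ((Fin n → G) →₀ k) →ₗ[k] ((Fin (n + 1) → G) →₀ k) :=
  Finsupp.lmapDomain k k Fin.partialProd

theorem toInhomogeneous_toHomogeneous (n : ℕ) (z : (Fin n → G) →₀ k) :
    toInhomogeneous k G n (toHomogeneous k G n z) = z := by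
  suffices h : toInhomogeneous k G n ∘ₗ toHomogeneous k G n = LinearMap.id from
    LinearMap.congr_fun h z
  refine Finsupp.lhom_ext' fun a => LinearMap.ext_ring ?_
  simp only [LinearMap.comp_apply, Finsupp.lsingle_apply, toHomogeneous,
    Finsupp.lmapDomain_apply, Finsupp.mapDomain_single, toInhomogeneous_single,
    Fin.partialProd_right_inv, LinearMap.id_apply]

variable (k) in
/-- The prism operator `P_g` on inhomogeneous chains, a homotopy from the identity to conjugation by
`g`. It is induced by the prism operator of right multiplication by `g` on homogeneous chains. -/
def barPrism (g : G) (n : ℕ) : ((Fin n → G) →₀ k) →ₗ[k] ((Fin (n + 1) → G) →₀ k) :=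
  toInhomogeneous k G (n + 1) ∘ₗ prism k (· * g) (n + 1) ∘ₗ toHomogeneous k G n

variable (k) in
/-- Conjugation `a ↦ g⁻¹ a g` on inhomogeneous chains. -/
def barConj (g : G) (n : ℕ) : ((Fin n → G) →₀ k) →ₗ[k] ((Fin n → G) →₀ k) :=
  pushTuple k (fun a => g⁻¹ * a * g) n

theorem barPrism_toInhomogeneous (g : G) (n : ℕ) (z : (Fin (n + 1) → G) →₀ k) :
    barPrism k g n (toInhomogeneous k G n z) =
      toInhomogeneous k G (n + 1) (prism k (· * g) (n + 1) z) := by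
  suffices h : barPrism k g n ∘ₗ toInhomogeneous k G n =
      toInhomogeneous k G (n + 1) ∘ₗ prism k (· * g) (n + 1) from LinearMap.congr_fun h z
  refine Finsupp.lhom_ext' fun a => LinearMap.ext_ring ?_
  -- Normalizing the first vertex of `a` to `1` is a left translation, which commutes with the
  -- prism operator and is invisible in inhomogeneous chains.
  have ha : toHomogeneous k G n (toInhomogeneous k G n (Finsupp.single a 1)) =
      pushTuple k ((a 0)⁻¹ * ·) (n + 1) (Finsupp.single a 1) := by
    rw [toInhomogeneous_single, pushTuple_single, toHomogeneous, Finsupp.lmapDomain_apply,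
      Finsupp.mapDomain_single]
    congr 1
    have h1 := Fin.partialProd_left_inv a
    funext l
    have h2 := congrFun h1 l
    rw [Pi.smul_apply, smul_eq_mul] at h2
    rw [Function.comp_apply, ← h2, inv_mul_cancel_left]
  simp only [LinearMap.comp_apply, Finsupp.lsingle_apply, barPrism]
  rw [ha, ← pushTuple_prism (f := ((a 0)⁻¹ * ·)) (r := (· * g))]
  · exact toInhomogeneous_translate k G _ _ _
  · funext x
    simp [mul_assoc]

theorem barConj_toInhomogeneous (g : G) (n : ℕ) (z : (Fin (n + 1) → G) →₀ k) :
    barConj k g n (toInhomogeneous k G n z) =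
      toInhomogeneous k G n (pushTuple k (· * g) (n + 1) z) := by
  suffices h : barConj k g n ∘ₗ toInhomogeneous k G n =
      toInhomogeneous k G n ∘ₗ pushTuple k (· * g) (n + 1) from LinearMap.congr_fun h z
  refine Finsupp.lhom_ext' fun a => LinearMap.ext_ring ?_
  simp only [LinearMap.comp_apply, Finsupp.lsingle_apply, barConj, pushTuple_single,
    toInhomogeneous_single]
  congr 1
  funext l
  simp [mul_assoc]

theorem barBoundary_barPrism (g : G) (n : ℕ) (z : (Fin (n + 1) → G) →₀ k) :
    barBoundary k G (n + 1) (barPrism k g (n + 1) z) =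
      barConj k g (n + 1) z - z - barPrism k g n (barBoundary k G n z) := by
  obtain ⟨w, rfl⟩ : ∃ w, toInhomogeneous k G (n + 1) w = z :=
    ⟨_, toInhomogeneous_toHomogeneous (n + 1) z⟩
  rw [barPrism_toInhomogeneous, barConj_toInhomogeneous, barBoundary, barBoundary,
    ← toInhomogeneous_boundary, ← toInhomogeneous_boundary, barPrism_toInhomogeneous,
    standardBoundary_eq_tupleBoundary, standardBoundary_eq_tupleBoundary, tupleBoundary_prism,
    map_sub, map_sub]

theorem barConj_barPrism (h g : G) (n : ℕ) (z : (Fin n → G) →₀ k) :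
    barConj k h (n + 1) (barPrism k g n z) =
      barPrism k (h⁻¹ * g * h) n (barConj k h n z) := by
  obtain ⟨w, rfl⟩ : ∃ w, toInhomogeneous k G n w = z := ⟨_, toInhomogeneous_toHomogeneous n z⟩
  rw [barPrism_toInhomogeneous, barConj_toInhomogeneous, barConj_toInhomogeneous,
    barPrism_toInhomogeneous, pushTuple_prism]
  funext x
  simp [mul_assoc]

/-- The torus spanned by `g` and `g` is degenerate. -/
theorem barPrism_self (g : G) : barPrism k g 1 (Finsupp.single (fun _ => g) 1) = 0 := by
  have h : (Finsupp.single (fun _ => g) 1 : (Fin 1 → G) →₀ k) =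
      toInhomogeneous k G 1 (prepend k 1 1 (prepend k g 0 (Finsupp.single Fin.elim0 1))) := by
    rw [prepend_single, prepend_single, toInhomogeneous_single]
    congr 1
    funext l
    rw [Subsingleton.elim l 0]
    simp
  rw [h, barPrism_toInhomogeneous]
  simp [prism, Fin.comp_cons]

/-- The chain `∑_{j < t} (g, g^j)`, whose boundary compares `t` times the loop `g` with the
loop `g^t`. -/
def powerChain (k : Type u) [CommRing k] (t : ℕ) (g : G) : (Fin 2 → G) →₀ k :=
  ∑ j ∈ Finset.range t, Finsupp.single ![g, g ^ j] 1

theorem barBoundary_powerChain (t : ℕ) (g : G) :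
    barBoundary k G 1 (powerChain k t g) = t • Finsupp.single (fun _ => g) 1 +
      (Finsupp.single (fun _ => 1) 1 - Finsupp.single (fun _ => g ^ t) 1) := by
  have hd : ∀ a b : G, barBoundary k G 1 (Finsupp.single ![a, b] 1) =
      Finsupp.single (fun _ => b) 1 - Finsupp.single (fun _ => a * b) 1 +
        Finsupp.single (fun _ => a) 1 := by
    intro a b
    have h := groupHomology.inhomogeneousChains.d_single (A := Rep.trivial k G k) 1
      ![a, b] (1 : k)
    refine h.trans ?_
    have e1 : (fun i : Fin 1 => (![a, b] : Fin 2 → G) i.succ) = fun _ => b := by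
      funext i; rw [Subsingleton.elim i 0]; rfl
    have e2 : Fin.contractNth 0 (· * ·) (![a, b] : Fin 2 → G) = fun _ => a * b := by
      funext i; rw [Subsingleton.elim i 0]; rfl
    have e3 : Fin.contractNth 1 (· * ·) (![a, b] : Fin 2 → G) = fun _ => a := by
      funext i; rw [Subsingleton.elim i 0]; rfl
    rw [Fin.sum_univ_two, e1, e2, e3]
    simp [sub_eq_add_neg, add_assoc]
  induction t with
  | zero => simp [powerChain]
  | succ t ih =>
    rw [powerChain, Finset.sum_range_succ, map_add, ← powerChain, ih, hd, succ_nsmul, pow_succ']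
    abel

theorem barConj_powerChain (t : ℕ) (h g : G) :
    barConj k h 2 (powerChain k t g) = powerChain k t (h⁻¹ * g * h) := by
  rw [powerChain, powerChain, map_sum]
  refine Finset.sum_congr rfl fun j _ => ?_
  rw [barConj, pushTuple_single]
  congr 1
  have hp : (h⁻¹ * g * h) ^ j = h⁻¹ * g ^ j * h := by
    simpa using (conj_pow (i := j) (a := h⁻¹) (b := g))
  funext l
  refine Fin.cases ?_ (fun l => ?_) l
  · simp
  · rw [Subsingleton.elim l 0]
    simp [hp]

end BarPrism

/-! ### Powers of the generators of a connected quandle of finite type -/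

namespace AssociatedGroup

variable {X : Type u} [Quandle X]

theorem e_mul_e_pow (x y : X) (n : ℕ) :
    e x * e y ^ n = e y ^ n * e ((fun z => Quandle.tri z y)^[n] x) := by
  induction n with
  | zero => simp
  | succ n ih =>
    rw [pow_succ, ← mul_assoc, ih, mul_assoc, e_mul_e, Function.iterate_succ_apply', mul_assoc]

theorem e_op_smul (g : AssociatedGroup X) (x : X) :
    e (MulOpposite.op g • x) = g⁻¹ * e x * g := by
  have hg : g ∈ Subgroup.closure (Set.range (e : X → AssociatedGroup X)) := by
    have h := PresentedGroup.closure_range_of (relators X)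
    exact h ▸ Subgroup.mem_top g
  induction hg using Subgroup.closure_induction generalizing x with
  | mem g hg =>
    obtain ⟨y, rfl⟩ := hg
    rw [op_e_smul, e_tri]
  | one => simp
  | mul g h _ _ ihg ihh =>
    rw [MulOpposite.op_mul, mul_smul, ihh, ihg]
    group
  | inv g _ ih =>
    have h := ih (MulOpposite.op g⁻¹ • x)
    rw [← mul_smul, ← MulOpposite.op_mul, inv_mul_cancel, MulOpposite.op_one, one_smul] at h
    rw [h]
    group

/-- If the `t`-fold operations are trivial, then the elements `e_x ^ t` are central. -/
theorem commute_e_pow {t : ℕ} (ht : ∀ x y : X, (fun z => Quandle.tri z y)^[t] x = x)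
    (g : AssociatedGroup X) (y : X) : Commute g (e y ^ t) := by
  have hg : g ∈ Subgroup.closure (Set.range (e : X → AssociatedGroup X)) := by
    have h := PresentedGroup.closure_range_of (relators X)
    exact h ▸ Subgroup.mem_top g
  induction hg using Subgroup.closure_induction with
  | mem g hg =>
    obtain ⟨x, rfl⟩ := hg
    change _ = _
    rw [e_mul_e_pow, ht]
  | one => exact Commute.one_left _
  | mul g h _ _ ihg ihh => exact ihg.mul_left ihh
  | inv g _ ih => exact ih.inv_left

/-- In a connected quandle the central elements `e_x ^ t` all agree, being conjugate. -/
theorem e_pow_eq_e_pow (hX : Quandle.IsConnected X) {t : ℕ}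
    (ht : ∀ x y : X, (fun z => Quandle.tri z y)^[t] x = x) (x y : X) : e x ^ t = e y ^ t := by
  obtain ⟨g, rfl⟩ := hX.exists_smul_eq x y
  have h : (g.unop⁻¹ * e x * g.unop) ^ t = g.unop⁻¹ * e x ^ t * g.unop := by
    simpa using (conj_pow (i := t) (a := g.unop⁻¹) (b := e x))
  have h2 := e_op_smul g.unop x
  rw [MulOpposite.op_unop] at h2
  rw [h2, h, ((commute_e_pow ht _ _).eq : g.unop⁻¹ * e x ^ t = _), inv_mul_cancel_right]

end AssociatedGroup

/-! ### The null-homotopy of `t` times the classifying map -/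

section NullHomotopy

open RackChain AssociatedGroup ClassifyingLift

variable {k : Type u} [CommRing k] {X : Type u} [Quandle X]

theorem chainMap_prismLift_tack (a : X) (n : ℕ) (z : (PUnit.{u + 1} × (Fin n → X)) →₀ k) :
    (prismLift k X).chainMap (n + 1) (tack a n z) =
      (-1 : k) ^ (n + 1) • barPrism k (e a) n ((prismLift k X).chainMap n z) := by
  obtain ⟨w, rfl⟩ : ∃ w, proj k X n w = z := ⟨_, proj_unitSheet n z⟩
  rw [tack_proj, chainMap_proj, chainMap_proj, barPrism_toInhomogeneous]
  change toInhomogeneous k _ _ (prismMap k X (n + 1) (tack a n w)) = _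
  rw [prismMap_tack, map_smul]
  rfl

theorem chainMap_prismLift_one_single (c : PUnit.{u + 1} × (Fin 1 → X)) :
    (prismLift k X).chainMap 1 (Finsupp.single c 1) =
      -Finsupp.single (fun _ => e (c.2 0)) 1 := by
  rw [chainMap_single _ _ _ 1]
  change toInhomogeneous k _ _ (prismMap k X 1 (Finsupp.single (1, c.2) 1)) = _
  simp only [prismMap, extend, Finsupp.linearCombination_single, one_smul, prism,
    LinearMap.smul_apply, LinearMap.comp_apply, LinearMap.zero_apply, map_zero, sub_zero,
    prepend_single, zero_add, pow_one, neg_smul, map_neg, toInhomogeneous_single]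
  congr 2
  funext l
  rw [Subsingleton.elim l 0]
  simp

/-- The rack space has a single vertex, so its `1`-cells are loops. -/
theorem bd_zero_eq_zero (z : (PUnit.{u + 1} × (Fin 1 → X)) →₀ k) : bd k X PUnit 0 z = 0 := by
  suffices h : bd k X PUnit 0 = 0 from LinearMap.congr_fun h z
  refine tack_hom_ext fun a w => ?_
  rw [bd_tack_zero, LinearMap.zero_apply, sub_eq_zero]
  suffices h : LinearMap.id = act (k := k) (Y := PUnit) a 0 from LinearMap.congr_fun h w
  refine Finsupp.lhom_ext' fun c => LinearMap.ext_ring ?_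
  simp only [LinearMap.comp_apply, Finsupp.lsingle_apply, LinearMap.id_apply, act_single]
  congr 1
  exact Prod.ext rfl (Subsingleton.elim _ _)

theorem augmentation_bd (n : ℕ) (z : (PUnit.{u + 1} × (Fin (n + 1) → X)) →₀ k) :
    augmentation k _ (bd k X PUnit n z) = 0 := by
  suffices h : augmentation k _ ∘ₗ bd k X PUnit n = 0 from LinearMap.congr_fun h z
  refine Finsupp.lhom_ext' fun c => LinearMap.ext_ring ?_
  simp only [LinearMap.comp_apply, Finsupp.lsingle_apply, LinearMap.zero_apply]
  rw [bd, PrecubicalSet.boundary_single, map_sum]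
  refine Finset.sum_eq_zero fun i _ => ?_
  rw [map_smul, map_sub]
  simp [augmentation]

theorem augmentation_act (a : X) (n : ℕ) (z : (PUnit.{u + 1} × (Fin n → X)) →₀ k) :
    augmentation k _ (act a n z) = augmentation k _ z := by
  suffices h : augmentation k _ ∘ₗ act a n = augmentation k _ from LinearMap.congr_fun h z
  refine Finsupp.lhom_ext' fun c => LinearMap.ext_ring ?_
  simp [augmentation]

variable (k X) in
/-- The null-homotopy of `t` times the classifying map in degrees at least two; the value at `n` is
its component on `(n + 1)`-chains. In degree one it is
`x ↦ -∑_{j < t} (e_x, e_x^j)`. Each further coordinate `a` contributes the prism operator of `e_a`,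
except that in degree two the chain of `a` itself is first subtracted; this cancels the loop
`e_x^t`, which does not depend on `x`. -/
def nullHomotopy (t : ℕ) : ∀ n : ℕ, ((PUnit.{u + 1} × (Fin (n + 1) → X)) →₀ k) →ₗ[k]
    ((Fin (n + 2) → AssociatedGroup X) →₀ k)
  | 0 => Finsupp.linearCombination k fun c => -powerChain k t (e (c.2 0))
  | 1 => extend fun a => -(barPrism k (e a) 2 ∘ₗ (nullHomotopy t 0 +
      (augmentation k _).smulRight (powerChain k t (e a))))
  | n + 2 => extend fun a => (-1 : k) ^ n • (barPrism k (e a) (n + 3) ∘ₗ nullHomotopy t (n + 1))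

theorem nullHomotopy_zero_single (t : ℕ) (c : PUnit.{u + 1} × (Fin 1 → X)) :
    nullHomotopy k X t 0 (Finsupp.single c 1) = -powerChain k t (e (c.2 0)) := by
  simp [nullHomotopy]

theorem nullHomotopy_one_tack (t : ℕ) (a : X) (z : (PUnit.{u + 1} × (Fin 1 → X)) →₀ k) :
    nullHomotopy k X t 1 (tack a 1 z) = -barPrism k (e a) 2
      (nullHomotopy k X t 0 z + augmentation k _ z • powerChain k t (e a)) :=
  extend_tack _ a z

theorem nullHomotopy_add_two_tack (t n : ℕ) (a : X)
    (z : (PUnit.{u + 1} × (Fin (n + 2) → X)) →₀ k) :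
    nullHomotopy k X t (n + 2) (tack a (n + 2) z) =
      (-1 : k) ^ n • barPrism k (e a) (n + 3) (nullHomotopy k X t (n + 1) z) := by
  rw [nullHomotopy, extend_tack]
  rfl

/-- On boundaries the correction term in degree two vanishes. -/
theorem nullHomotopy_tack_bd (t n : ℕ) (a : X) (z : (PUnit.{u + 1} × (Fin (n + 2) → X)) →₀ k) :
    nullHomotopy k X t (n + 1) (tack a (n + 1) (bd k X PUnit (n + 1) z)) =
      (-1 : k) ^ (n + 1) •
        barPrism k (e a) (n + 2) (nullHomotopy k X t n (bd k X PUnit (n + 1) z)) := by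
  cases n with
  | zero =>
    rw [nullHomotopy_one_tack, augmentation_bd]
    simp
  | succ n =>
    rw [nullHomotopy_add_two_tack, pow_succ, pow_succ]
    simp

theorem nullHomotopy_act (t n : ℕ) (a : X) (z : (PUnit.{u + 1} × (Fin (n + 1) → X)) →₀ k) :
    nullHomotopy k X t n (act a (n + 1) z) =
      barConj k (e a) (n + 2) (nullHomotopy k X t n z) := by
  have h0 : ∀ z : (PUnit.{u + 1} × (Fin 1 → X)) →₀ k, nullHomotopy k X t 0 (act a 1 z) =
      barConj k (e a) 2 (nullHomotopy k X t 0 z) := by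
    intro z
    suffices h : nullHomotopy k X t 0 ∘ₗ act a 1 = barConj k (e a) 2 ∘ₗ nullHomotopy k X t 0 from
      LinearMap.congr_fun h z
    refine Finsupp.lhom_ext' fun c => LinearMap.ext_ring ?_
    simp only [LinearMap.comp_apply, Finsupp.lsingle_apply, act_single, nullHomotopy_zero_single,
      map_neg, barConj_powerChain, e_tri]
  suffices h : nullHomotopy k X t n ∘ₗ act a (n + 1) =
      barConj k (e a) (n + 2) ∘ₗ nullHomotopy k X t n from LinearMap.congr_fun h z
  clear z
  induction n with
  | zero => exact LinearMap.ext h0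
  | succ n ih =>
    refine tack_hom_ext fun b z => ?_
    have ih' := LinearMap.congr_fun ih z
    simp only [LinearMap.comp_apply] at ih' ⊢
    cases n with
    | zero =>
      rw [act_tack, nullHomotopy_one_tack, nullHomotopy_one_tack, map_neg, barConj_barPrism,
        map_add (barConj k _ _), map_smul (barConj k _ _), barConj_powerChain, ← e_tri, h0,
        augmentation_act]
    | succ n =>
      rw [act_tack, nullHomotopy_add_two_tack, nullHomotopy_add_two_tack, map_smul,
        barConj_barPrism, ih', e_tri]

/-- The homotopy formula `t c = d H + H ∂` in degrees at least two. The step from one degree to the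
next is formal. In degree two, with `h(x) = ∑_{j < t} (e_x, e_x^j)`, it holds because
`d h(x) - d h(a) = t (e_x) - t (e_a)`, the conjugation by `e_a` fixes `h(a)`, and the prism operator
of `e_a` kills the loop `e_a`. -/
theorem smul_chainMap_prismLift {t : ℕ} (ht : ∀ x y : X, e x ^ t = e y ^ t) (n : ℕ)
    (z : (PUnit.{u + 1} × (Fin (n + 2) → X)) →₀ k) :
    t • (prismLift k X).chainMap (n + 2) z =
      barBoundary k _ (n + 2) (nullHomotopy k X t (n + 1) z) +
        nullHomotopy k X t n (bd k X PUnit (n + 1) z) := by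
  suffices h : t • (prismLift k X).chainMap (n + 2) =
      barBoundary k _ (n + 2) ∘ₗ nullHomotopy k X t (n + 1) +
        nullHomotopy k X t n ∘ₗ bd k X PUnit (n + 1) from LinearMap.congr_fun h z
  clear z
  induction n with
  | zero =>
    refine tack_hom_ext fun a z => ?_
    simp only [LinearMap.smul_apply, LinearMap.add_apply, LinearMap.comp_apply]
    -- The loops `e_x ^ t` and `e_a ^ t` agree, hence cancel.
    have h1 : t • (prismLift k X).chainMap 1 z +
        augmentation k _ z • t • Finsupp.single (fun _ => e a) 1 =
        barBoundary k _ 1 (nullHomotopy k X t 0 z + augmentation k _ z • powerChain k t (e a)) := by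
      suffices h : t • (prismLift k X).chainMap 1 +
          (augmentation k _).smulRight (t • Finsupp.single (fun _ => e a) 1) =
          barBoundary k _ 1 ∘ₗ (nullHomotopy k X t 0 +
            (augmentation k _).smulRight (powerChain k t (e a))) from LinearMap.congr_fun h z
      refine Finsupp.lhom_ext' fun c => LinearMap.ext_ring ?_
      simp only [LinearMap.comp_apply, Finsupp.lsingle_apply, LinearMap.add_apply,
        LinearMap.smul_apply, LinearMap.smulRight_apply, augmentation,
        Finsupp.linearCombination_single, one_smul, nullHomotopy_zero_single]
      rw [chainMap_prismLift_one_single, map_add, map_neg, barBoundary_powerChain,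
        barBoundary_powerChain, ht (c.2 0) a, smul_neg]
      abel
    have h2 := congrArg (barPrism k (e a) 1) h1
    rw [map_add, map_nsmul, map_smul, map_nsmul, barPrism_self, smul_zero, smul_zero,
      add_zero] at h2
    rw [chainMap_prismLift_tack, nullHomotopy_one_tack, map_neg, barBoundary_barPrism, ← h2,
      bd_tack_succ, bd_zero_eq_zero, map_zero, map_add (nullHomotopy k X t 0), map_zero,
      map_smul (nullHomotopy k X t 0), map_sub (nullHomotopy k X t 0), nullHomotopy_act,
      map_add (barConj k _ _), map_smul (barConj k _ _), barConj_powerChain, inv_mul_cancel,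
      one_mul]
    simp
  | succ n ih =>
    refine tack_hom_ext fun a z => ?_
    have ih' := congrArg (barPrism k (e a) (n + 2)) (LinearMap.congr_fun ih z)
    simp only [LinearMap.smul_apply, LinearMap.add_apply, LinearMap.comp_apply] at ih' ⊢
    rw [map_nsmul, map_add] at ih'
    rw [chainMap_prismLift_tack, smul_comm, ih', nullHomotopy_add_two_tack, map_smul,
      barBoundary_barPrism, bd_tack_succ, map_add, nullHomotopy_tack_bd, map_smul, map_sub,
      nullHomotopy_act, pow_succ, pow_succ, pow_succ]
    module

end NullHomotopy

/-- An elementwise criterion for `t` to annihilate the map induced on homology: `t` times the image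
of each cycle bounds. -/
theorem HomologicalComplex.smul_homologyMap_eq_zero {k : Type u} [CommRing k]
    {K L : ChainComplex (ModuleCat.{u} k) ℕ} (f : K ⟶ L) (n t : ℕ)
    (h : ∀ x : K.X (n + 1), (K.d (n + 1) n).hom x = 0 →
      ∃ y : L.X (n + 2), t • (f.f (n + 1)).hom x = (L.d (n + 2) (n + 1)).hom y)
    (z : K.homology (n + 1)) : t • (HomologicalComplex.homologyMap f (n + 1)).hom z = 0 := by
  obtain ⟨w, rfl⟩ := (ModuleCat.epi_iff_surjective (K.homologyπ (n + 1))).1 inferInstance z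
  have hw : (K.d (n + 1) n).hom ((K.iCycles (n + 1)).hom w) = 0 := by
    have := K.iCycles_d (n + 1) n
    exact LinearMap.congr_fun (congrArg ModuleCat.Hom.hom this) w
  obtain ⟨y, hy⟩ := h _ hw
  have h1 : t • (HomologicalComplex.cyclesMap f (n + 1)).hom w =
      (L.toCycles (n + 2) (n + 1)).hom y := by
    apply (ModuleCat.mono_iff_injective (L.iCycles (n + 1))).1 inferInstance
    have h2 := LinearMap.congr_fun
      (congrArg ModuleCat.Hom.hom (HomologicalComplex.cyclesMap_i f (n + 1))) w
    have h3 := LinearMap.congr_fun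
      (congrArg ModuleCat.Hom.hom (L.toCycles_i (n + 2) (n + 1))) y
    simp only [ModuleCat.hom_comp, LinearMap.comp_apply] at h2 h3
    refine (map_nsmul (L.iCycles (n + 1)).hom t _).trans ?_
    rw [h2, hy]
    exact h3.symm
  have h4 := LinearMap.congr_fun
    (congrArg ModuleCat.Hom.hom (HomologicalComplex.homologyπ_naturality f (n + 1))) w
  have h5 := LinearMap.congr_fun
    (congrArg ModuleCat.Hom.hom (L.toCycles_comp_homologyπ (n + 2) (n + 1))) y
  simp only [ModuleCat.hom_comp, LinearMap.comp_apply] at h4 h5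
  have h6 := congrArg (L.homologyπ (n + 1)).hom h1
  rw [map_nsmul] at h6
  exact (congrArg (t • ·) h4).trans (h6.trans h5)

/-- In every degree at least two, `t` annihilates the map on homology induced by the classifying
map. -/
theorem ClassifyingLift.smul_homologyMap_eq_zero {k : Type u} [CommRing k] {X : Type u} [Quandle X]
    (hX : Quandle.IsConnected X) {t : ℕ} (ht : Quandle.IsOfType X t) (φ : ClassifyingLift k X)
    (n : ℕ) (z : ((rackSpace X).cellularComplex k).homology (n + 2)) :
    t • (φ.homologyMap (n + 2)).hom z = 0 := by
  refine HomologicalComplex.smul_homologyMap_eq_zero φ.toChainMap (n + 1) t (fun x hx => ?_) z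
  have hx' : RackChain.bd k X PUnit (n + 1) x = 0 := by
    rw [PrecubicalSet.cellularComplex_d] at hx
    exact hx
  obtain ⟨w, hw⟩ := exists_chainMap_sub_eq φ (prismLift k X) (n + 1) x hx'
  have h1 := smul_chainMap_prismLift (k := k) (AssociatedGroup.e_pow_eq_e_pow hX ht.1.2) n x
  rw [hx', map_zero, add_zero] at h1
  refine ⟨t • w + nullHomotopy k X t (n + 1) x, ?_⟩
  rw [groupHomology.inhomogeneousChains.d_def]
  change t • φ.chainMap (n + 2) x = barBoundary k _ (n + 2) _
  rw [map_add, map_nsmul, ← hw, ← h1, smul_sub, sub_add_cancel]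

end

theorem mainTheorem4 {X : Type u} [Quandle X] (hX : Quandle.IsConnected X)
    (t : ℕ) (ht : Quandle.IsOfType X t) (n : ℕ) (hn : n = 2 ∨ n = 3)
    (φ : ClassifyingLift (ULift.{u} ℤ) X)
    (z : ((rackSpace X).cellularComplex (ULift.{u} ℤ)).homology n) :
    t • (φ.homologyMap n).hom z = 0 := by
  rcases hn with rfl | rfl
  · exact φ.smul_homologyMap_eq_zero hX ht 0 z
  · exact φ.smul_homologyMap_eq_zero hX ht 1 z
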